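/- **Theorem (Fricke vanishing of the defects).** Let $\chi_3=\left(\frac{\cdot}{3}\right)$ and consider the Laurent series in $q=e^{2\pi i\tau}$ \[ C(q)=3E_{5,\chi_0,\chi_3}=1+3\sum_{n\ge1}\Bigl(\sum_{d\mid n}\chi_3(d)d^4\Bigr)q^n, \qquad t(q)=\frac{\eta(3\tau)^{12}}{\eta(\tau)^{12}}=q\prod_{n\ge1}\frac{(1-q^{3n})^{12}}{(1-q^n)^{12}}, \] where $E_{5,\chi_0,\chi_3}=-\frac{B_{5,\chi_3}}{10}+\sum_{n\ge1}\bigl(\sum_{d\mid n}\chi_3(d)d^4\bigr)q^n$ and $B_{5,\chi_3}$ is the generalized Bernoulli number. For a prime $p$ and a Laurent series $f=\sum_{n\gg-\infty}a_nq^n$ put $\Lambda_p(f)=\sum_{n\gg-\infty}a_{np}q^n$, and for $r\ge1$ and $1\le s\le r$ put \[ F_r(q)=\Lambda_p\!\left(\frac{C(q)}{t(q)^{rp}}\right)-\frac{C(q)}{t(q)^r}, \qquad \delta_{r,s}=[q^{-r+s}]F_r(q). \] Then for every prime $p\ge5$ and every $r\in\{1,2,3\}$, \[ F_r(q)\equiv0\pmod{p^4},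 \] that is, every coefficient of $F_r$ lies in $p^4\mathbf{Z}_{(p)}$. Equivalently, for every prime $p\ge5$, \[ \delta_{r,s}\equiv0\pmod{p^4}\qquad(1\le s\le r\le3); \] more precisely, for each $r\in\{1,2,3\}$ one has $F_r\equiv0\pmod{p^4}$ if and only if $\delta_{r,s}\equiv0\pmod{p^4}$ for all $1\le s\le r$, and both hold. -/

import Mathlib

noncomputable section

namespace FrickeDefect

section Products
open scoped PowerSeries.WithPiTopology

/-- The formal infinite product `∏_{n ≥ 1} (1 - q^(d n))` in `ℚ⟦q⟧` (with its topology of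
coefficientwise convergence). Up to the factor `q^(d/24)` it is the `q`-expansion of the
Dedekind eta function `η(d τ)`, where `q = exp(2 π i τ)`. -/
def eulerProduct (d : ℕ) : PowerSeries ℚ :=
  ∏' n : ℕ, ((1 : PowerSeries ℚ) - PowerSeries.X ^ (d * (n + 1)))

/-- The product defining `eulerProduct d` converges for `d ≥ 1`. -/
theorem multipliable_eulerProduct (d : ℕ) (hd : 0 < d) :
    Multipliable fun n : ℕ => (1 : PowerSeries ℚ) - PowerSeries.X ^ (d * (n + 1)) := by
  simp_rw [sub_eq_add_neg]
  apply PowerSeries.WithPiTopology.multipliable_one_add_of_tendsto_order_atTop_nhds_top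
  refine ENat.tendsto_nhds_top_iff_natCast_lt.mpr (fun n => Filter.eventually_atTop.mpr ⟨n, ?_⟩)
  intro m hm
  rw [PowerSeries.order_neg, PowerSeries.order_X_pow]
  norm_cast
  nlinarith

/-- The constant term of the product is `1`. -/
theorem constantCoeff_eulerProduct (d : ℕ) (hd : 0 < d) :
    PowerSeries.constantCoeff (eulerProduct d) = 1 := by
  rw [eulerProduct, (multipliable_eulerProduct d hd).map_tprod _
    (PowerSeries.WithPiTopology.continuous_constantCoeff ℚ)]
  simp [hd.ne']

end Products

/-- The `q`-expansion of the Hauptmodul `t = η(3τ)^12 / η(τ)^12`, that is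
`t(q) = q * ∏_{n ≥ 1} (1 - q^(3n))^12 / (1 - q^n)^12`, as a Laurent series in `q`; the factor `q`
is `q^(12 * 3 / 24) / q^(12 * 1 / 24)`. -/
def t : LaurentSeries ℚ :=
  HahnSeries.single 1 1 * (eulerProduct 3 : LaurentSeries ℚ) ^ 12 /
    (eulerProduct 1 : LaurentSeries ℚ) ^ 12

/-- The generalized Bernoulli number
`B_{k,χ} = N^(k-1) * ∑_{a=1}^{N} χ(a) B_k(a/N)` of a rational-valued Dirichlet character
modulo `N` (written with `N^k / N` so that no natural-number subtraction occurs). -/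
def generalizedBernoulli (k : ℕ) {N : ℕ} (χ : DirichletCharacter ℚ N) : ℚ :=
  (N : ℚ) ^ k / N *
    ∑ a ∈ Finset.Icc 1 N, χ (a : ZMod N) * (Polynomial.bernoulli k).eval ((a : ℚ) / N)

/-- The `q`-expansion of the Eisenstein series `E_{k,χ₀,χ}` (`χ₀` the trivial character),
`E_{k,χ₀,χ} = -B_{k,χ} / (2k) + ∑_{n ≥ 1} (∑_{d ∣ n} χ(d) d^(k-1)) q^n`.
The constant term is `L(1 - k, χ) / 2`. -/
def eisensteinQExp (k : ℕ) {N : ℕ} (χ : DirichletCharacter ℚ N) : PowerSeries ℚ :=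
  PowerSeries.mk fun n =>
    if n = 0 then -generalizedBernoulli k χ / (2 * k)
    else ∑ d ∈ n.divisors, χ (d : ZMod N) * (d : ℚ) ^ (k - 1)

/-- The quadratic character `χ₃ = (· / 3)` modulo `3`, with rational values. -/
def chi3 : DirichletCharacter ℚ 3 :=
  (quadraticChar (ZMod 3)).ringHomComp (Int.castRingHom ℚ)

/-- `C = 3 E_{5,χ₀,χ₃}` as a Laurent series in `q`. -/
def C : LaurentSeries ℚ :=
  ((3 * eisensteinQExp 5 chi3 : PowerSeries ℚ) : LaurentSeries ℚ)

/-- Decimating the coefficients of a Laurent series keeps the support bounded below. -/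
theorem bddBelow_support_Lambda (p : ℕ) [NeZero p] (f : LaurentSeries ℚ) :
    BddBelow (Function.support fun n : ℤ => f.coeff (n * p)) := by
  refine ⟨-|f.order|, fun n hn => ?_⟩
  have h1 : f.order ≤ n * p := HahnSeries.order_le_of_coeff_ne_zero hn
  have h2 : (1 : ℤ) ≤ p := by exact_mod_cast Nat.one_le_iff_ne_zero.mpr (NeZero.ne p)
  have h3 : -|f.order| ≤ f.order := neg_abs_le _
  by_contra! h4
  have h5 : n < 0 := lt_of_lt_of_le h4 (by simp)
  nlinarith

/-- The operator `Λ_p (∑ a_n q^n) = ∑ a_{np} q^n` on Laurent series. -/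
def Lambda (p : ℕ) [NeZero p] (f : LaurentSeries ℚ) : LaurentSeries ℚ :=
  HahnSeries.ofSuppBddBelow (fun n : ℤ => f.coeff (n * p)) (bddBelow_support_Lambda p f)

/-- The defect `F_r = Λ_p(C / t^(rp)) - C / t^r`. -/
def defect (p : ℕ) [NeZero p] (r : ℕ) : LaurentSeries ℚ :=
  Lambda p (C / t ^ (r * p)) - C / t ^ r

/-- The principal-part coefficient `δ_{r,s} = [q^(-r+s)] F_r`. -/
def delta (p : ℕ) [NeZero p] (r s : ℕ) : ℚ :=
  (defect p r).coeff (-(r : ℤ) + s)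

/-- Congruence `x ≡ y (mod p^k)` in the localization of `ℤ` at the prime `p`, for rational `x`
and `y`: the difference is `p^k` times a rational number with denominator prime to `p`. -/
def RatModEq (p k : ℕ) (x y : ℚ) : Prop :=
  ∃ z : ℚ, ¬ p ∣ z.den ∧ x - y = (p : ℚ) ^ k * z

/-- Coefficientwise congruence modulo `p^k` of Laurent series. -/
def SeriesModEq (p k : ℕ) (f g : LaurentSeries ℚ) : Prop :=
  ∀ n : ℤ, RatModEq p k (f.coeff n) (g.coeff n)

end FrickeDefect

end

/-!
For every prime `p ≥ 5` and every `r ≥ 0`, all coefficients of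
`Λ_p (C / t^(rp)) - C / t^r` are divisible by `p^4`; both sides of the equivalence with the
congruences for the `δ_{r,s}` are therefore true.

`C` is a form of weight `5` and character `χ₃` on `Γ₀(3)`, and `t` has a zero at `i ∞` and a pole
at the cusp `0`. The Fricke involution `τ ↦ -1/(3τ)` exchanges the cusps. It sends `t` to
`1/(729 t)` and `C` to a constant times the second Eisenstein series
`G = ∑ (∑_{d ∣ n} χ₃(n/d) d^4) q^n`, so that `C / t^j = q^(-j) + ⋯` and
`G t^j = q^(j+1) + ⋯` are conjugate (`isFrickePair_inftyForm`). This is read off from the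
lattice sums `∑ χ₃(d) (3cτ + d)^(-5)` and `∑ χ₃(c) (cτ + d)^(-5)`, whose `q`-expansions follow from
the Lipschitz formula.

The Hecke operator `T_p` commutes with the involution up to the factor `χ₃(p)`
(`IsFrickePair.hecke`). Subtract from `T_p (C / t^m)` the integral combination `∑ A_j C / t^j`
with the same principal part and constant term. The difference vanishes at both cusps, and such a
form of weight `5` on `Γ₀(3)` is zero (`IsFrickePair.eq_zero`, by the maximum principle for
`(f g)^12 / (η(τ) η(3τ))^120`). Hence `T_p (C / t^m) = ∑ A_j C / t^j`, and conjugation gives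
`χ₃(p) 729^m T_p (G t^m) = ∑ A_j 729^j G t^j` with the same `A_j` (`exists_hecke_combination`).

Modulo `p^4` the operator `T_p` is `Λ_p`. For `m = rp` the series `Λ_p (C / t^(rp))` starts with
`q^(-r)`, which forces `A_j ≡ 0` for `j > r` and `A_r ≡ 1`, while `Λ_p (G t^(rp))` vanishes to order
at least `r + 1`, which forces `A_j ≡ 0` for `j < r` since `729` is a unit modulo `p`
(`dvd_sub_of_two_cusps`). What remains is `Λ_p (C / t^(rp)) ≡ C / t^r`.
-/

namespace FrickeDefect

open Finset Filter Topology
open Complex (I)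

/-! ### Integer combinations of triangular systems of `q`-expansions -/

/-- If `f j = q^(-j) + ⋯` for every `j`, then the principal part and the constant term of an
integral `q`-expansion of pole order at most `M` agree with those of an integral combination of
`f 0, …, f M`. -/
lemma exists_principalPart_combination (f : ℕ → ℤ → ℤ)
    (hf : ∀ (j : ℕ) (n : ℤ), n < -j → f j n = 0) (hf1 : ∀ j : ℕ, f j (-j) = 1)
    (M : ℕ) (h : ℤ → ℤ) (hh : ∀ n : ℤ, n < -M → h n = 0) :
    ∃ A : ℕ → ℤ, ∀ n ≤ 0, h n = ∑ j ∈ range (M + 1), A j * f j n := by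
  induction M generalizing h with
  | zero =>
    refine ⟨fun _ => h 0, fun n hn => ?_⟩
    rcases hn.eq_or_lt with rfl | hn
    · have := hf1 0
      simp_all
    · simp [hf 0 n (by simpa using hn), hh n (by simpa using hn)]
  | succ M ih =>
    obtain ⟨A, hA⟩ := ih (fun n => h n - h (-(M + 1 : ℕ)) * f (M + 1) n) (fun n hn => by
      rcases (show n ≤ -(M + 1 : ℕ) by push_cast; lia).eq_or_lt with rfl | hn'
      · simp only [hf1, mul_one, sub_self]
      · simp [hf _ n hn', hh n hn'])
    refine ⟨Function.update A (M + 1) (h (-(M + 1 : ℕ))), fun n hn => ?_⟩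
    rw [sum_range_succ, Function.update_self, ← sub_eq_iff_eq_add, hA n hn]
    refine sum_congr rfl fun j hj => ?_
    rw [Function.update_of_ne (by simp at hj; lia)]

/-- Let `h = ∑ A j * f j` with `f j = q^(-j) + ⋯`, and let `u * h' = ∑ A j * w ^ j * g j` with
`g j = q^(j+1) + ⋯` be the expansion of the same combination at another cusp, where `w` is prime
to `N`. If, modulo `N`, the pole order of `h` is at most `r` with leading coefficient `1`, and `h'`
vanishes to order at least `r + 1`, then `h ≡ f r` modulo `N`: the behaviour of `h` kills `A j` for
`j > r`, that of `h'` kills `A j` for `j < r`. -/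
lemma dvd_sub_of_two_cusps {N u w : ℤ} (hw : IsCoprime N w) {f g : ℕ → ℤ → ℤ}
    (hf : ∀ (j : ℕ) (n : ℤ), n < -j → f j n = 0) (hf1 : ∀ j : ℕ, f j (-j) = 1)
    (hg : ∀ (j : ℕ) (n : ℤ), n < j + 1 → g j n = 0) (hg1 : ∀ j : ℕ, g j (j + 1) = 1)
    {M r : ℕ} (hr : r ≤ M) {h h' : ℤ → ℤ} {A : ℕ → ℤ}
    (hh : ∀ n, h n = ∑ j ∈ range (M + 1), A j * f j n)
    (hh' : ∀ n, u * h' n = ∑ j ∈ range (M + 1), A j * w ^ j * g j n)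
    (h0 : ∀ n : ℤ, n < -r → N ∣ h n) (h1 : N ∣ h (-r) - 1)
    (h0' : ∀ n : ℤ, n < r + 1 → N ∣ h' n) (n : ℤ) :
    N ∣ h n - f r n := by
  have hlow : ∀ j < r, N ∣ A j := by
    intro j
    induction j using Nat.strong_induction_on with
    | _ j ih =>
    intro hj
    have key := hh' (j + 1)
    rw [← sum_erase_add _ _ (mem_range.2 (by lia : j < M + 1)), hg1, mul_one] at key
    have h2 : N ∣ ∑ i ∈ (range (M + 1)).erase j, A i * w ^ i * g i (j + 1) := by
      refine dvd_sum fun i hi => ?_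
      rcases lt_or_gt_of_ne (ne_of_mem_erase hi) with hij | hij
      · exact ((ih i hij (by lia)).mul_right _).mul_right _
      · simp [hg i (j + 1) (by lia)]
    have h3 : N ∣ A j * w ^ j := by
      rw [← dvd_add_right h2, ← key]
      exact (h0' _ (by lia)).mul_left _
    exact hw.pow_right.dvd_of_dvd_mul_right h3
  have hhigh : ∀ k j, j + k = M → r < j → N ∣ A j := by
    intro k
    induction k using Nat.strong_induction_on with
    | _ k ih =>
    intro j hjk hj
    have key := hh (-j)
    rw [← sum_erase_add _ _ (mem_range.2 (by lia : j < M + 1)), hf1, mul_one] at key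
    have h2 : N ∣ ∑ i ∈ (range (M + 1)).erase j, A i * f i (-j) := by
      refine dvd_sum fun i hi => ?_
      rcases lt_or_gt_of_ne (ne_of_mem_erase hi) with hij | hij
      · simp [hf i (-j) (by lia)]
      · have := mem_range.1 (mem_of_mem_erase hi)
        exact (ih (M - i) (by lia) i (by lia) (by lia)).mul_right _
    rw [← dvd_add_right h2, ← key]
    exact h0 _ (by lia)
  have hne : ∀ j ∈ (range (M + 1)).erase r, N ∣ A j := by
    intro j hj
    rcases lt_or_gt_of_ne (ne_of_mem_erase hj) with hij | hij
    · exact hlow j hij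
    · have := mem_range.1 (mem_of_mem_erase hj)
      exact hhigh (M - j) j (by lia) hij
  have hsplit : ∀ n, h n = ∑ j ∈ (range (M + 1)).erase r, A j * f j n + A r * f r n := fun n => by
    rw [hh n, sum_erase_add _ _ (mem_range.2 (by lia : r < M + 1))]
  have hsum : ∀ n, N ∣ ∑ j ∈ (range (M + 1)).erase r, A j * f j n := fun n =>
    dvd_sum fun j hj => (hne j hj).mul_right _
  have hAr : N ∣ A r - 1 := by
    rw [hsplit, hf1, mul_one, add_sub_assoc] at h1
    exact (dvd_add_right (hsum _)).1 h1
  have : h n - f r n = ∑ j ∈ (range (M + 1)).erase r, A j * f j n + (A r - 1) * f r n := by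
    rw [hsplit]; ring
  rw [this]
  exact dvd_add (hsum n) (hAr.mul_right _)

/-! ### Expansions in the nome -/

/-- The nome `q = exp(2 π i τ)`. -/
noncomputable def nome (τ : ℂ) : ℂ := Complex.exp (2 * Real.pi * I * τ)

lemma nome_ne_zero (τ : ℂ) : nome τ ≠ 0 := Complex.exp_ne_zero _

lemma norm_nome (τ : ℂ) : ‖nome τ‖ = Real.exp (-2 * Real.pi * τ.im) := by
  rw [nome, Complex.norm_exp]
  congr 1
  simp

lemma norm_nome_pos (τ : ℂ) : 0 < ‖nome τ‖ := norm_pos_iff.2 (nome_ne_zero τ)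

lemma norm_nome_lt_one {τ : ℂ} (hτ : 0 < τ.im) : ‖nome τ‖ < 1 := by
  rw [norm_nome, Real.exp_lt_one_iff]
  have := mul_pos Real.pi_pos hτ
  linarith

lemma nome_add (τ σ : ℂ) : nome (τ + σ) = nome τ * nome σ := by
  rw [nome, mul_add, Complex.exp_add]; rfl

lemma nome_nat_mul (k : ℕ) (τ : ℂ) : nome (k * τ) = nome τ ^ k := by
  rw [nome, nome, ← Complex.exp_nat_mul]
  ring_nf

lemma nome_int (k : ℤ) : nome k = 1 := by
  rw [nome, Complex.exp_eq_one_iff]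
  exact ⟨k, by ring⟩

lemma nome_add_int (τ : ℂ) (k : ℤ) : nome (τ + k) = nome τ := by
  rw [nome_add, nome_int, mul_one]

lemma differentiable_nome : Differentiable ℂ nome := by
  unfold nome
  fun_prop

/-- The nome tends to `0` at `i ∞`. -/
lemma exists_norm_nome_lt {ε : ℝ} (hε : 0 < ε) :
    ∃ Y : ℝ, 1 ≤ Y ∧ ∀ τ : ℂ, Y ≤ τ.im → ‖nome τ‖ < ε := by
  obtain ⟨Y, hY⟩ := (Real.tendsto_exp_atBot.eventually (gt_mem_nhds hε)).exists_forall_of_atBot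
  refine ⟨max 1 (-Y), le_max_left _ _, fun τ hτ => ?_⟩
  rw [norm_nome]
  apply hY
  have h1 := (le_max_left _ _).trans hτ
  have h2 := (le_max_right _ _).trans hτ
  nlinarith [Real.pi_gt_three]

/-- `f` is given on the upper half-plane by the series `∑ a n q^n`, indexed by the integers. -/
def HasQExpansion (a : ℤ → ℂ) (f : ℂ → ℂ) : Prop :=
  ∀ τ : ℂ, 0 < τ.im → HasSum (fun n : ℤ => a n * nome τ ^ n) (f τ)

lemma HasQExpansion.sub {a b : ℤ → ℂ} {f g : ℂ → ℂ} (hf : HasQExpansion a f)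
    (hg : HasQExpansion b g) : HasQExpansion (fun n => a n - b n) (fun τ => f τ - g τ) :=
  fun τ hτ => by simpa only [sub_mul] using (hf τ hτ).sub (hg τ hτ)

lemma HasQExpansion.const_mul {a : ℤ → ℂ} {f : ℂ → ℂ} (c : ℂ) (hf : HasQExpansion a f) :
    HasQExpansion (fun n => c * a n) (fun τ => c * f τ) :=
  fun τ hτ => by simpa only [mul_assoc] using (hf τ hτ).mul_left c

lemma HasQExpansion.sum {ι : Type*} {s : Finset ι} {a : ι → ℤ → ℂ} {f : ι → ℂ → ℂ}
    (hf : ∀ i ∈ s, HasQExpansion (a i) (f i)) :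
    HasQExpansion (fun n => ∑ i ∈ s, a i n) (fun τ => ∑ i ∈ s, f i τ) :=
  fun τ hτ => by simpa only [sum_mul] using hasSum_sum fun i hi => hf i hi τ hτ

lemma HasQExpansion.congr {a b : ℤ → ℂ} {f g : ℂ → ℂ} (hf : HasQExpansion a f) (hab : ∀ n, a n = b n)
    (hfg : ∀ τ : ℂ, 0 < τ.im → f τ = g τ) : HasQExpansion b g := fun τ hτ => by
  simpa only [← hab, ← hfg τ hτ] using hf τ hτ

lemma HasQExpansion.periodic {a : ℤ → ℂ} {f : ℂ → ℂ} (hf : HasQExpansion a f) {τ : ℂ}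
    (hτ : 0 < τ.im) (k : ℤ) : f (τ + k) = f τ := by
  have h := hf (τ + k) (by simpa using hτ)
  rw [nome_add_int] at h
  exact h.unique (hf τ hτ)

/-- A function whose expansion starts with `q^k` is `O(q^k)` at `i ∞`. -/
lemma HasQExpansion.exists_norm_le {a : ℤ → ℂ} {f : ℂ → ℂ} (hf : HasQExpansion a f) {k : ℤ}
    (ha : ∀ n < k, a n = 0) :
    ∃ K : ℝ, 0 ≤ K ∧ ∀ τ : ℂ, 1 ≤ τ.im → ‖f τ‖ ≤ K * ‖nome τ‖ ^ k := by
  have hI := (hf I (by simp)).summable.norm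
  have hr := norm_nome_pos I
  set r := ‖nome I‖ with hrdef
  refine ⟨(∑' n, ‖a n * nome I ^ n‖) * (r ^ k)⁻¹,
    mul_nonneg (tsum_nonneg fun _ => norm_nonneg _) (by positivity), fun τ hτ => ?_⟩
  have hle : ‖nome τ‖ ≤ r := by
    rw [hrdef, norm_nome, norm_nome, Real.exp_le_exp]
    have := Real.pi_pos
    simp only [Complex.I_im]
    nlinarith
  have hpos := norm_nome_pos τ
  have hs := hI.mul_right ((r ^ k)⁻¹ * ‖nome τ‖ ^ k)
  rw [mul_assoc, ← tsum_mul_right, ← (hf τ (by linarith)).tsum_eq]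
  refine tsum_of_norm_bounded hs.hasSum fun n => ?_
  rcases lt_or_ge n k with hn | hn
  · simp [ha n hn]
  · obtain ⟨m, rfl⟩ := Int.le.dest hn
    rw [norm_mul, norm_mul, norm_zpow, norm_zpow, ← hrdef, zpow_add₀ hpos.ne', zpow_add₀ hr.ne',
      zpow_natCast, zpow_natCast, mul_assoc]
    have h1 : r ^ k * r ^ m * ((r ^ k)⁻¹ * ‖nome τ‖ ^ k) = ‖nome τ‖ ^ k * r ^ m := by
      field_simp
    rw [h1]
    gcongr

/-- The coefficients of an expansion with finite principal part are determined by the function. -/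
lemma HasQExpansion.eq_zero {a : ℤ → ℂ} {f : ℂ → ℂ} (hf : HasQExpansion a f)
    (hf0 : ∀ τ : ℂ, 0 < τ.im → f τ = 0) {M : ℤ} (ha : ∀ n < M, a n = 0) (n : ℤ) : a n = 0 := by
  suffices H : ∀ k : ℕ, ∀ n < M + k, a n = 0 from H (n - M + 1).toNat n (by lia)
  intro k
  induction k with
  | zero => simpa using ha
  | succ k ih =>
    suffices h0 : a (M + k) = 0 by
      intro n hn
      rcases (show n ≤ M + k by push_cast at hn; lia).eq_or_lt with rfl | h
      · exact h0
      · exact ih n h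
    have hg : HasQExpansion (fun n => if n = M + k then 0 else a n)
        (fun τ => -(a (M + k) * nome τ ^ (M + k : ℤ))) := fun τ hτ => by
      have h1 := hf τ hτ
      rw [hf0 τ hτ] at h1
      have h2 := h1.sub (hasSum_ite_eq (M + k : ℤ) (a (M + k) * nome τ ^ (M + k : ℤ)))
      rw [zero_sub] at h2
      refine h2.congr_fun fun n => ?_
      by_cases h : n = M + k <;> simp [h]
    obtain ⟨K, hK0, hK⟩ := hg.exists_norm_le (k := M + k + 1) (fun n hn => by
      split_ifs with h
      · rfl
      · exact ih n (by lia))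
    by_contra hne
    obtain ⟨Y, hY1, hY⟩ := exists_norm_nome_lt (ε := ‖a (M + k)‖ / (K + 1))
      (div_pos (norm_pos_iff.2 hne) (by linarith))
    have hτ : Y ≤ (Y * I : ℂ).im := by simp
    have h1 := hK (Y * I) (by linarith)
    have h2 := hY _ hτ
    have hpos := norm_nome_pos (Y * I : ℂ)
    rw [norm_neg, norm_mul, norm_zpow, zpow_add₀ hpos.ne' (M + k) 1, zpow_one, mul_comm,
      mul_left_comm] at h1
    have h3 := le_of_mul_le_mul_left h1 (zpow_pos hpos _)
    rw [lt_div_iff₀ (by linarith)] at h2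
    nlinarith

/-- An expansion without principal part defines a holomorphic function. -/
lemma HasQExpansion.differentiableOn {a : ℤ → ℂ} {f : ℂ → ℂ} (hf : HasQExpansion a f)
    (ha : ∀ n < 0, a n = 0) : DifferentiableOn ℂ f {τ | 0 < τ.im} := by
  intro τ₀ hτ₀
  set y := τ₀.im / 2 with hy
  have hτ₀' : 0 < τ₀.im := hτ₀
  have hy0 : 0 < y := by positivity
  have hU : IsOpen {τ : ℂ | y < τ.im} := isOpen_lt continuous_const Complex.continuous_im
  have hI := (hf (y * I) (by simpa using hy0)).summable.norm
  have hd : DifferentiableOn ℂ (fun τ => ∑' n : ℤ, a n * nome τ ^ n) {τ : ℂ | y < τ.im} := by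
    refine Complex.differentiableOn_tsum_of_summable_norm hI (fun n => ?_) hU fun n τ hτ => ?_
    · exact ((differentiable_nome.zpow (Or.inl nome_ne_zero)).const_mul _).differentiableOn
    · rcases lt_or_ge n 0 with hn | hn
      · simp [ha n hn]
      · lift n to ℕ using hn
        rw [norm_mul, norm_mul, zpow_natCast, zpow_natCast, norm_pow, norm_pow]
        gcongr
        rw [norm_nome, norm_nome, Real.exp_le_exp]
        have := Real.pi_pos
        have hτ' : y < τ.im := hτ
        simp
        nlinarith
  have hmem : {τ : ℂ | y < τ.im} ∈ 𝓝 τ₀ := hU.mem_nhds (by simp [hy]; linarith)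
  have h1 := (hd.differentiableAt hmem)
  refine (h1.congr_of_eventuallyEq ?_).differentiableWithinAt
  filter_upwards [hmem] with τ hτ
  exact (hf τ (hy0.trans hτ)).tsum_eq.symm

/-! ### Vanishing of forms with zeros at both cusps -/

lemma im_fricke (τ : ℂ) : (-1 / (3 * τ)).im = τ.im / (3 * Complex.normSq τ) := by
  have h : -1 / (3 * τ) = ((-3⁻¹ : ℝ) : ℂ) * τ⁻¹ := by
    push_cast
    rw [div_eq_mul_inv, mul_inv]
    ring
  rw [h, Complex.im_ofReal_mul, Complex.inv_im]
  ring

lemma im_fricke_pos {τ : ℂ} (hτ : 0 < τ.im) : 0 < (-1 / (3 * τ)).im := by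
  rw [im_fricke]
  have : 0 < Complex.normSq τ := Complex.normSq_pos.2 fun h => by simp [h] at hτ
  positivity

lemma ne_zero_of_im_pos {τ : ℂ} (hτ : 0 < τ.im) : τ ≠ 0 := fun h => by simp [h] at hτ

/-- Every orbit of the group generated by `τ ↦ τ + 1` and `τ ↦ -1/(3τ)` on the upper half-plane
meets the region `|Re τ| ≤ 1/2`, `Im τ ≥ 1/4`. -/
lemma exists_orbit_im_ge {P : ℂ → Prop} (hT : ∀ (τ : ℂ) (k : ℤ), 0 < τ.im → P τ → P (τ + k))
    (hW : ∀ τ : ℂ, 0 < τ.im → P τ → P (-1 / (3 * τ))) {τ : ℂ} (hτ : 0 < τ.im) (hP : P τ) :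
    ∃ σ : ℂ, 1 / 4 ≤ σ.im ∧ |σ.re| ≤ 1 / 2 ∧ P σ := by
  obtain ⟨k, hk⟩ := exists_pow_lt_of_lt_one hτ (by norm_num : (15 / 16 : ℝ) < 1)
  induction k generalizing τ with
  | zero =>
    refine ⟨τ + (-round τ.re : ℤ), ?_, ?_, hT τ _ hτ hP⟩
    · simp at hk ⊢
      linarith
    · simpa [← sub_eq_add_neg] using abs_sub_round τ.re
  | succ k ih =>
    have hσP := hT τ (-round τ.re) hτ hP
    have hσim : (τ + (-round τ.re : ℤ)).im = τ.im := by simp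
    have hσre : |(τ + (-round τ.re : ℤ)).re| ≤ 1 / 2 := by
      simpa [← sub_eq_add_neg] using abs_sub_round τ.re
    set σ := τ + (-round τ.re : ℤ)
    rcases le_or_gt (1 / 4) σ.im with h | h
    · exact ⟨σ, h, hσre, hσP⟩
    · have hσ : 0 < σ.im := by rwa [hσim]
      refine ih (im_fricke_pos hσ) (hW σ hσ hσP) ?_
      -- below height `1/4` the involution raises the imaginary part by a factor `≥ 16/15`
      have hpos : 0 < Complex.normSq σ := Complex.normSq_pos.2 (ne_zero_of_im_pos hσ)
      have hn : 3 * Complex.normSq σ ≤ 15 / 16 := by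
        rw [Complex.normSq_apply]
        have := abs_le.1 hσre
        nlinarith
      rw [im_fricke, hσim, lt_div_iff₀ (by positivity)]
      rw [pow_succ] at hk
      have := pow_pos (by norm_num : (0 : ℝ) < 15 / 16) k
      nlinarith

/-- Maximum principle: a holomorphic function on the upper half-plane which is invariant under
`τ ↦ τ + 1` and `τ ↦ -1/(3τ)` and tends to `0` at `i ∞` vanishes. -/
lemma eq_zero_of_fricke_invariant {F : ℂ → ℂ} (hd : DifferentiableOn ℂ F {τ | 0 < τ.im})
    (hT : ∀ (τ : ℂ) (k : ℤ), 0 < τ.im → F (τ + k) = F τ)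
    (hW : ∀ τ : ℂ, 0 < τ.im → F (-1 / (3 * τ)) = F τ)
    (hlim : ∀ ε > 0, ∃ Y : ℝ, ∀ τ : ℂ, Y ≤ τ.im → ‖F τ‖ < ε) {τ : ℂ} (hτ : 0 < τ.im) :
    F τ = 0 := by
  have hmove : ∀ τ : ℂ, 0 < τ.im → ∃ σ : ℂ, 1 / 4 ≤ σ.im ∧ |σ.re| ≤ 1 / 2 ∧ F σ = F τ :=
    fun τ hτ => exists_orbit_im_ge (P := fun σ => F σ = F τ)
      (fun σ k hσ h => (hT σ k hσ).trans h) (fun σ hσ h => (hW σ hσ).trans h) hτ rfl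
  by_contra hne
  -- the supremum of `‖F‖` is attained on a compact rectangle, so `F` is constant, hence its limit
  obtain ⟨σ₁, h1im, h1re, h1F⟩ := hmove τ hτ
  obtain ⟨Y, hY⟩ := hlim ‖F τ‖ (norm_pos_iff.2 hne)
  have hσ₁Y : σ₁.im ≤ Y := by
    by_contra! h
    have := hY σ₁ h.le
    rw [h1F] at this
    exact this.false
  let K : Set ℂ := Set.Icc (-(1 / 2)) (1 / 2) ×ℂ Set.Icc (1 / 4) Y
  have hK : IsCompact K := isCompact_Icc.reProdIm isCompact_Icc
  have hKH : K ⊆ {τ | 0 < τ.im} := fun z hz => by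
    have h : 1 / 4 ≤ z.im := hz.2.1
    have : (0 : ℝ) < z.im := by linarith
    exact this
  have hσ₁K : σ₁ ∈ K := ⟨abs_le.1 h1re, h1im, hσ₁Y⟩
  obtain ⟨z₀, hz₀K, hz₀⟩ := hK.exists_isMaxOn ⟨σ₁, hσ₁K⟩ (hd.continuousOn.mono hKH).norm
  have hge : ‖F τ‖ ≤ ‖F z₀‖ := h1F ▸ hz₀ hσ₁K
  have hmax : IsMaxOn (norm ∘ F) {τ | 0 < τ.im} z₀ := by
    intro w hw
    obtain ⟨σ, him, hre, hF⟩ := hmove w hw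
    change ‖F w‖ ≤ ‖F z₀‖
    rw [← hF]
    rcases le_or_gt σ.im Y with h | h
    · exact hz₀ (⟨abs_le.1 hre, him, h⟩ : σ ∈ K)
    · exact (hY σ h.le).le.trans hge
  have hconst := Complex.eqOn_of_isPreconnected_of_isMaxOn_norm
    (convex_halfSpace_im_gt 0).isPreconnected (isOpen_lt continuous_const Complex.continuous_im)
    hd (hKH hz₀K) hmax
  obtain ⟨Y', hY'⟩ := hlim ‖F z₀‖ ((norm_pos_iff.2 hne).trans_le hge)
  have h1 := hY' ((max 1 Y' : ℝ) * I) (by simp)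
  have h2 : F ((max 1 Y' : ℝ) * I) = F z₀ := hconst (by simp)
  rw [h2] at h1
  exact h1.false

/-- The transformation of the twelfth power of `η` under `τ ↦ -1/τ`. -/
lemma exists_eta_pow_twelve_neg_inv :
    ∃ s : ℂ, s ^ 2 = 1 ∧ ∀ τ : ℂ, 0 < τ.im →
      ModularForm.eta (-1 / τ) ^ 12 = s * τ ^ 6 * ModularForm.eta τ ^ 12 := by
  have hs : ∀ z : ℂ, z ≠ 0 → Complex.sqrt z ^ 12 = z ^ 6 := fun z hz => by
    rw [sqrt_eq_exp hz, ← Complex.exp_nat_mul,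
      show ((12 : ℕ) : ℂ) * (Complex.log z / 2) = (6 : ℕ) * Complex.log z by push_cast; ring,
      Complex.exp_nat_mul, Complex.exp_log hz]
  refine ⟨((I : ℂ) ^ 6)⁻¹, ?_, fun τ hτ => ?_⟩
  · rw [inv_pow, ← pow_mul, show 6 * 2 = 4 * 3 by norm_num, pow_mul, Complex.I_pow_four]
    simp
  · have h := ModularForm.eta_comp_eq_csqrt_I_inv (show τ ∈ UpperHalfPlane.upperHalfPlaneSet from hτ)
    simp only [Function.comp_apply, Pi.smul_apply, Pi.mul_apply, smul_eq_mul] at h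
    rw [h, mul_pow, mul_pow, inv_pow, hs _ Complex.I_ne_zero, hs _ (ne_zero_of_im_pos hτ)]
    ring

lemma eta_pow_twentyfour_neg_inv {τ : ℂ} (hτ : 0 < τ.im) :
    ModularForm.eta (-1 / τ) ^ 24 = τ ^ 12 * ModularForm.eta τ ^ 24 := by
  obtain ⟨s, hs, h⟩ := exists_eta_pow_twelve_neg_inv
  rw [show 24 = 12 * 2 by norm_num, pow_mul, h τ hτ, mul_pow, mul_pow, hs]
  ring

lemma eta_pow_twentyfour_eq (τ : ℂ) :
    ModularForm.eta τ ^ 24 = nome τ * (∏' n : ℕ, (1 - nome τ ^ (n + 1))) ^ 24 := by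
  have h1 : Function.Periodic.qParam 24 τ ^ 24 = nome τ := by
    rw [Function.Periodic.qParam, ← Complex.exp_nat_mul, nome]
    congr 1
    push_cast
    ring
  simp only [ModularForm.eta, mul_pow, h1, ModularForm.eta_q_eq_pow]
  rfl

/-- `(η(τ) η(3τ))^120`, a form of weight `120` without zeros which vanishes to order `20` at
either cusp. -/
noncomputable def etaWeight (τ : ℂ) : ℂ :=
  (ModularForm.eta τ ^ 24 * ModularForm.eta (3 * τ) ^ 24) ^ 5

lemma im_three_mul (τ : ℂ) : (3 * τ).im = 3 * τ.im := by simp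

lemma etaWeight_ne_zero {τ : ℂ} (hτ : 0 < τ.im) : etaWeight τ ≠ 0 := by
  have h1 := ModularForm.eta_ne_zero (show τ ∈ UpperHalfPlane.upperHalfPlaneSet from hτ)
  have h2 := ModularForm.eta_ne_zero (z := 3 * τ)
    (show 0 < (3 * τ).im by rw [im_three_mul]; linarith)
  unfold etaWeight
  positivity

lemma etaWeight_add_int (τ : ℂ) (k : ℤ) : etaWeight (τ + k) = etaWeight τ := by
  have h : 3 * (τ + k) = 3 * τ + ((3 * k : ℤ) : ℂ) := by push_cast; ring
  simp only [etaWeight, eta_pow_twentyfour_eq, h, nome_add_int]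

lemma etaWeight_fricke {τ : ℂ} (hτ : 0 < τ.im) :
    etaWeight (-1 / (3 * τ)) = 3 ^ 60 * τ ^ 120 * etaWeight τ := by
  have h0 := ne_zero_of_im_pos hτ
  have h : 3 * (-1 / (3 * τ)) = -1 / τ := by field_simp
  rw [etaWeight, h, eta_pow_twentyfour_neg_inv hτ,
    eta_pow_twentyfour_neg_inv (by rw [im_three_mul]; linarith : 0 < (3 * τ).im), etaWeight]
  ring

lemma differentiableOn_etaWeight : DifferentiableOn ℂ etaWeight {τ | 0 < τ.im} := by
  intro τ hτ
  have h1 := ModularForm.differentiableAt_eta_of_mem_upperHalfPlaneSet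
    (show τ ∈ UpperHalfPlane.upperHalfPlaneSet from hτ)
  have h2 := ModularForm.differentiableAt_eta_of_mem_upperHalfPlaneSet (z := 3 * τ)
    (show 0 < (3 * τ).im by rw [im_three_mul]; have : 0 < τ.im := hτ; linarith)
  have h3 : DifferentiableAt ℂ (fun τ => ModularForm.eta (3 * τ)) τ :=
    h2.comp τ (by fun_prop)
  exact (((h1.pow 24).mul (h3.pow 24)).pow 5).differentiableWithinAt

/-- `etaWeight` vanishes at `i ∞` to order exactly `20`: the product factors tend to `1`. -/
lemma exists_le_norm_etaWeight :
    ∃ c Y : ℝ, 0 < c ∧ ∀ τ : ℂ, Y ≤ τ.im → c * ‖nome τ‖ ^ 20 ≤ ‖etaWeight τ‖ := by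
  have hcont : ContinuousAt (fun q : ℂ => ∏' n : ℕ, (1 - q ^ (n + 1))) 0 :=
    (ModularForm.differentiableOn_tprod_one_sub_pow.differentiableAt
      (Metric.isOpen_ball.mem_nhds (by simp))).continuousAt
  have h0 : Tendsto (fun q : ℂ => ‖∏' n : ℕ, (1 - q ^ (n + 1))‖) (𝓝 0) (𝓝 1) := by
    have := hcont.norm.tendsto
    simpa using this
  obtain ⟨δ, hδ, hball⟩ := Metric.eventually_nhds_iff.1 (h0.eventually (lt_mem_nhds
    (by norm_num : (1 / 2 : ℝ) < 1)))
  obtain ⟨Y, hY1, hY⟩ := exists_norm_nome_lt hδ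
  refine ⟨(1 / 2) ^ 240, Y, by positivity, fun τ hτ => ?_⟩
  have h1 := hball (y := nome τ) (by simpa using hY τ hτ)
  have h3 : Y ≤ (3 * τ).im := by rw [im_three_mul]; linarith
  have h2 := hball (y := nome (3 * τ)) (by simpa using hY _ h3)
  have h4 : nome (3 * τ) = nome τ ^ 3 := by exact_mod_cast nome_nat_mul 3 τ
  rw [etaWeight, eta_pow_twentyfour_eq, eta_pow_twentyfour_eq]
  simp only [norm_mul, norm_pow]
  rw [h4] at h2 ⊢
  rw [norm_pow]
  set A := ‖∏' n : ℕ, (1 - nome τ ^ (n + 1))‖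
  set B := ‖∏' n : ℕ, (1 - (nome τ ^ 3) ^ (n + 1))‖
  have hA : (1 / 2 : ℝ) ^ 120 ≤ A ^ 120 := pow_le_pow_left₀ (by norm_num) h1.le _
  have hB : (1 / 2 : ℝ) ^ 120 ≤ B ^ 120 := pow_le_pow_left₀ (by norm_num) h2.le _
  calc (1 / 2 : ℝ) ^ 240 * ‖nome τ‖ ^ 20
      = ‖nome τ‖ ^ 20 * ((1 / 2 : ℝ) ^ 120 * (1 / 2 : ℝ) ^ 120) := by ring
    _ ≤ ‖nome τ‖ ^ 20 * (A ^ 120 * B ^ 120) := by gcongr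
    _ = _ := by ring

/-- `(f, g)` is a Fricke pair of weight `5`: `f(-1/(3τ)) = τ^5 g(τ)` on the upper half-plane. -/
def IsFrickePair (f g : ℂ → ℂ) : Prop :=
  ∀ τ : ℂ, 0 < τ.im → f (-1 / (3 * τ)) = τ ^ 5 * g τ

lemma IsFrickePair.symm_apply {f g : ℂ → ℂ} (h : IsFrickePair f g) {τ : ℂ} (hτ : 0 < τ.im) :
    g (-1 / (3 * τ)) = -(3 * τ) ^ 5 * f τ := by
  have h0 := ne_zero_of_im_pos hτ
  have h1 := h _ (im_fricke_pos hτ)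
  rw [show -1 / (3 * (-1 / (3 * τ))) = τ by field_simp] at h1
  rw [h1]
  field_simp

/-- A weight `5` form on `Γ₀(3)` with a zero at each of the two cusps is `0`. The valence of such a
form is `5 * 4 / 12 < 2`; analytically, `(f g)^12` has weight `120` and vanishes to order `24` at
the cusps, so its quotient by `etaWeight` is an invariant function tending to `0` there. -/
lemma IsFrickePair.eq_zero {f g : ℂ → ℂ} (h : IsFrickePair f g) {a b : ℤ → ℂ}
    (hf : HasQExpansion a f) (hg : HasQExpansion b g) (ha : ∀ n ≤ 0, a n = 0)
    (hb : ∀ n ≤ 0, b n = 0) {τ : ℂ} (hτ : 0 < τ.im) : f τ = 0 := by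
  have hfd := hf.differentiableOn fun n hn => ha n hn.le
  have hgd := hg.differentiableOn fun n hn => hb n hn.le
  obtain ⟨Kf, hKf0, hKf⟩ := hf.exists_norm_le (k := 1) fun n hn => ha n (by lia)
  obtain ⟨Kg, hKg0, hKg⟩ := hg.exists_norm_le (k := 1) fun n hn => hb n (by lia)
  obtain ⟨c, Y₀, hc, hc'⟩ := exists_le_norm_etaWeight
  have hprod : ∀ τ : ℂ, 0 < τ.im → (f τ * g τ) ^ 12 / etaWeight τ = 0 := by
    intro τ hτ
    refine eq_zero_of_fricke_invariant (F := fun τ => (f τ * g τ) ^ 12 / etaWeight τ)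
      (((hfd.mul hgd).pow 12).div differentiableOn_etaWeight fun τ hτ => etaWeight_ne_zero hτ)
      (fun τ k hτ => ?_) (fun τ hτ => ?_) (fun ε hε => ?_) hτ
    · simp only [hf.periodic hτ, hg.periodic hτ, etaWeight_add_int]
    · have h0 := ne_zero_of_im_pos hτ
      simp only [h τ hτ, h.symm_apply hτ, etaWeight_fricke hτ]
      rw [show (τ ^ 5 * g τ * (-(3 * τ) ^ 5 * f τ)) ^ 12
        = (3 ^ 60 * τ ^ 120) * (f τ * g τ) ^ 12 by ring]
      exact mul_div_mul_left _ _ (mul_ne_zero (by norm_num) (pow_ne_zero _ h0))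
    · obtain ⟨Y, hY1, hY⟩ := exists_norm_nome_lt (ε := min 1 (ε * c / ((Kf * Kg) ^ 12 + 1)))
        (by positivity)
      refine ⟨max Y Y₀, fun τ hτ => ?_⟩
      have hτ1 : 1 ≤ τ.im := hY1.trans ((le_max_left _ _).trans hτ)
      have hq := hY τ ((le_max_left _ _).trans hτ)
      have hE := hc' τ ((le_max_right _ _).trans hτ)
      have h1 := hKf τ hτ1
      have h2 := hKg τ hτ1
      rw [zpow_one] at h1 h2
      have hpos := norm_nome_pos τ
      set x := ‖nome τ‖
      have hx1 : x < 1 := hq.trans_le (min_le_left _ _)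
      have hx2 := hq.trans_le (min_le_right _ _)
      rw [lt_div_iff₀ (by positivity)] at hx2
      have hEpos : 0 < ‖etaWeight τ‖ := lt_of_lt_of_le (by positivity) hE
      rw [norm_div, div_lt_iff₀ hEpos, norm_pow, norm_mul]
      calc (‖f τ‖ * ‖g τ‖) ^ 12 ≤ (Kf * x * (Kg * x)) ^ 12 := by gcongr
        _ = (x * (Kf * Kg) ^ 12) * (x ^ 3 * x ^ 20) := by ring
        _ ≤ (x * (Kf * Kg) ^ 12) * (1 * x ^ 20) := by
            gcongr
            exact pow_le_one₀ hpos.le hx1.le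
        _ < (ε * c) * (1 * x ^ 20) := by
            refine mul_lt_mul_of_pos_right ?_ (by positivity)
            nlinarith
        _ = ε * (c * x ^ 20) := by ring
        _ ≤ ε * ‖etaWeight τ‖ := by gcongr
  -- `f g = 0` on the half-plane, so one of the two factors vanishes identically
  have hUo : IsOpen {τ : ℂ | 0 < τ.im} := isOpen_lt continuous_const Complex.continuous_im
  have hUc : IsPreconnected {τ : ℂ | 0 < τ.im} := (convex_halfSpace_im_gt 0).isPreconnected
  have hfg : ∀ τ : ℂ, 0 < τ.im → f τ = 0 ∨ g τ = 0 := fun τ hτ => by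
    simpa [etaWeight_ne_zero hτ] using hprod τ hτ
  rcases AnalyticOnNhd.eq_zero_or_eq_zero_of_smul_eq_zero (hfd.analyticOnNhd hUo)
    (hgd.analyticOnNhd hUo) (fun τ hτ => by simpa using hfg τ hτ) hUc with h0 | h0
  · exact h0 τ hτ
  · have h1 := h.symm_apply hτ
    rw [h0 _ (im_fricke_pos hτ)] at h1
    have := ne_zero_of_im_pos hτ
    simpa [this] using h1.symm

/-! ### Transformation under `Γ₀(3)` -/

/-- The quadratic character modulo `3` as an integer-valued function. -/
noncomputable def legendreThree (n : ℤ) : ℤ := quadraticChar (ZMod 3) (n : ZMod 3)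

lemma legendreThree_add_three_mul (n k : ℤ) :
    legendreThree (n + 3 * k) = legendreThree n := by
  have : ((3 : ℤ) : ZMod 3) = 0 := by decide
  simp only [legendreThree, Int.cast_add, Int.cast_mul, this, zero_mul, add_zero]

lemma legendreThree_one : legendreThree 1 = 1 := by simp [legendreThree]

lemma legendreThree_neg_one : legendreThree (-1) = -1 := by
  simp only [legendreThree]
  decide

lemma legendreThree_zero : legendreThree 0 = 0 := by simp [legendreThree]

lemma legendreThree_neg (n : ℤ) : legendreThree (-n) = -legendreThree n := by
  rw [neg_eq_neg_one_mul, legendreThree, Int.cast_mul, map_mul]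
  change legendreThree (-1) * legendreThree n = _
  rw [legendreThree_neg_one, neg_one_mul]

lemma legendreThree_sq {n : ℤ} (hn : ¬ 3 ∣ n) : legendreThree n ^ 2 = 1 := by
  have : (n : ZMod 3) ≠ 0 := fun h => hn (by exact_mod_cast (ZMod.intCast_zmod_eq_zero_iff_dvd n 3).1 h)
  exact quadraticChar_sq_one this

lemma int_mul_add_int_ne_zero {τ : ℂ} (hτ : 0 < τ.im) {c d : ℤ} (h : c ≠ 0 ∨ d ≠ 0) :
    (c * τ + d : ℂ) ≠ 0 := by
  intro h0
  have him := congrArg Complex.im h0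
  simp only [Complex.add_im, Complex.mul_im, Complex.intCast_re, Complex.intCast_im, zero_mul,
    add_zero, Complex.zero_im, mul_eq_zero, Int.cast_eq_zero, hτ.ne', or_false] at him
  subst him
  simp at h0 h
  exact h h0

/-- Division with remainder of least absolute value. -/
lemma exists_two_mul_abs_add_mul_le (x : ℤ) {y : ℤ} (hy : y ≠ 0) :
    ∃ k : ℤ, 2 * |x + k * y| ≤ |y| := by
  refine ⟨-round ((x : ℚ) / y), ?_⟩
  have h := abs_sub_round ((x : ℚ) / y)
  have hy' : (y : ℚ) ≠ 0 := by exact_mod_cast hy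
  have h2 : (x + -round ((x : ℚ) / y) * y : ℚ) = (x / y - round ((x : ℚ) / y)) * y := by
    field_simp
    ring
  have h3 : |(x + -round ((x : ℚ) / y) * y : ℚ)| ≤ 1 / 2 * |(y : ℚ)| := by
    rw [h2, abs_mul]
    gcongr
  have h4 : 2 * |(x + -round ((x : ℚ) / y) * y : ℚ)| ≤ |(y : ℚ)| := by linarith
  exact_mod_cast h4

/-- Invariance under translation by integers. -/
def IsPeriodic (f : ℂ → ℂ) : Prop := ∀ (τ : ℂ) (k : ℤ), 0 < τ.im → f (τ + k) = f τ

/-- The conjugate of a translation by the Fricke involution. -/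
lemma IsFrickePair.apply_lower {f g : ℂ → ℂ} (h : IsFrickePair f g) (hg : IsPeriodic g) {τ : ℂ}
    (hτ : 0 < τ.im) (k : ℤ) :
    0 < (τ / (3 * k * τ + 1)).im ∧ f (τ / (3 * k * τ + 1)) = (3 * k * τ + 1) ^ 5 * f τ := by
  have h0 := ne_zero_of_im_pos hτ
  have hσ := im_fricke_pos hτ
  have hk : (3 * k * τ + 1 : ℂ) ≠ 0 := by
    have := int_mul_add_int_ne_zero hτ (c := 3 * k) (d := 1) (by simp)
    push_cast at this
    exact this
  have hσk : 0 < (-1 / (3 * τ) + (-k : ℤ)).im := by simpa using hσ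
  have hne := ne_zero_of_im_pos hσk
  have e1 : -1 / (3 * τ) + (-k : ℤ) = -(3 * k * τ + 1) / (3 * τ) := by
    field_simp
    push_cast
    ring
  have h1 : τ / (3 * k * τ + 1) = -1 / (3 * (-1 / (3 * τ) + (-k : ℤ))) := by
    rw [e1]
    field_simp
  rw [h1]
  refine ⟨im_fricke_pos hσk, ?_⟩
  have h2 := h _ hσ
  rw [show -1 / (3 * (-1 / (3 * τ))) = τ by field_simp] at h2
  rw [h _ hσk, hg _ _ hσ, e1, h2]
  field_simp

/-- Both members of a Fricke pair of periodic functions are modular of weight `5` on `Γ₀(3)` with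
character `χ₃`. Euclid's algorithm on the lower row reduces a matrix of `Γ₀(3)` to a translation
using translations and their conjugates by the Fricke involution. -/
lemma IsFrickePair.apply_gammaZero {f g : ℂ → ℂ} (h : IsFrickePair f g) (hf : IsPeriodic f)
    (hg : IsPeriodic g) (a b c d : ℤ) (hdet : a * d - 3 * b * c = 1) {τ : ℂ} (hτ : 0 < τ.im) :
    f ((a * τ + b) / (3 * c * τ + d)) = legendreThree d * (3 * c * τ + d) ^ 5 * f τ := by
  induction hn : c.natAbs using Nat.strong_induction_on generalizing a b c d τ with
  | _ n ih =>
  subst hn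
  by_cases hc : c = 0
  · subst hc
    have had : a * d = 1 := by simpa using hdet
    rcases Int.eq_one_or_neg_one_of_mul_eq_one had with rfl | rfl
    · obtain rfl : d = 1 := by lia
      simpa [legendreThree_one] using hf τ b hτ
    · obtain rfl : d = -1 := by lia
      have := hf τ (-b) hτ
      simp only [legendreThree_neg_one]
      push_cast at this ⊢
      rw [← this]
      ring_nf
  -- two division steps replace the lower row `(3c, d)` by `(3c, d')` and then `(3(c + l d'), d')`
  · obtain ⟨k, hk⟩ := exists_two_mul_abs_add_mul_le d (y := 3 * c) (by lia)
    set d' := d + k * (3 * c) with hd'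
    have hdet' : a * d' - 3 * (b + a * k) * c = 1 := by rw [hd', ← hdet]; ring
    have hd'0 : d' ≠ 0 := by
      intro h0
      rw [h0] at hdet'
      lia
    obtain ⟨l, hl⟩ := exists_two_mul_abs_add_mul_le c hd'0
    set τ' : ℂ := τ + (-k : ℤ) with hτ'
    have hτ'im : 0 < τ'.im := by simpa [hτ'] using hτ
    obtain ⟨hσim, hσ⟩ := h.apply_lower hg hτ'im (-l)
    have hs : (3 * (-l : ℤ) * τ' + 1 : ℂ) ≠ 0 := by
      have := int_mul_add_int_ne_zero hτ'im (c := 3 * (-l)) (d := 1) (by simp)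
      push_cast at this ⊢
      exact this
    have hden : (3 * c * τ + d : ℂ) ≠ 0 := by
      have := int_mul_add_int_ne_zero hτ (c := 3 * c) (d := d) (by simp [hc])
      push_cast at this
      exact this
    have hlt : (c + l * d').natAbs < c.natAbs := by
      rw [abs_mul, show |(3 : ℤ)| = 3 from rfl] at hk
      have := abs_pos.2 hc
      zify
      linarith
    have key := ih _ hlt (a + 3 * l * (b + a * k)) (b + a * k) (c + l * d') d'
      (by rw [← hdet']; ring) hσim rfl
    set s : ℂ := 3 * (-l : ℤ) * τ' + 1 with hsdef
    have e1 : 3 * ((c + l * d' : ℤ) : ℂ) * (τ' / s) + (d' : ℂ) = (3 * c * τ + d) / s := by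
      rw [eq_div_iff hs, add_mul, mul_assoc, div_mul_cancel₀ _ hs, hsdef, hτ', hd']
      push_cast
      ring
    have e2 : ((a + 3 * l * (b + a * k) : ℤ) : ℂ) * (τ' / s) + ((b + a * k : ℤ) : ℂ)
        = (a * τ + b) / s := by
      rw [eq_div_iff hs, add_mul, mul_assoc, div_mul_cancel₀ _ hs, hsdef, hτ']
      push_cast
      ring
    rw [e1, e2, hσ, div_div_div_cancel_right₀ hs, hf τ _ hτ, hd', mul_left_comm k 3 c,
      legendreThree_add_three_mul] at key
    rw [key]
    field_simp

/-! ### The Hecke operator -/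

/-- The Hecke operator `T_p` of weight `5` and character `χ₃`. -/
noncomputable def hecke (p : ℕ) (f : ℂ → ℂ) (τ : ℂ) : ℂ :=
  (∑ b ∈ range p, f ((τ + b) / p)) / p + legendreThree p * p ^ 4 * f (p * τ)

/-- The effect of `T_p` on the coefficients of a `q`-expansion. -/
noncomputable def heckeCoeff (p : ℕ) (a : ℤ → ℤ) (n : ℤ) : ℤ :=
  a (p * n) + legendreThree p * p ^ 4 * (if (p : ℤ) ∣ n then a (n / p) else 0)

/-- Averaging over the translates `(τ + b)/p` selects the exponents divisible by `p`. -/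
lemma sum_nome_zpow {p : ℕ} (hp : 0 < p) (n : ℤ) :
    ∑ b ∈ range p, nome ((b : ℂ) / p) ^ n = if (p : ℤ) ∣ n then (p : ℂ) else 0 := by
  have hp' : (p : ℂ) ≠ 0 := by exact_mod_cast hp.ne'
  have hζ : IsPrimitiveRoot (nome (1 / p)) p := by
    have := Complex.isPrimitiveRoot_exp p hp.ne'
    rwa [nome, mul_one_div]
  have h1 : ∀ b : ℕ, nome ((b : ℂ) / p) ^ n = (nome (1 / p) ^ n) ^ b := fun b => by
    rw [← mul_one_div, nome_nat_mul, ← zpow_natCast, ← zpow_natCast, ← zpow_mul, ← zpow_mul,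
      mul_comm]
  simp_rw [h1]
  split_ifs with h
  · rw [(hζ.zpow_eq_one_iff_dvd n).2 h]
    simp
  · have hne : nome (1 / p) ^ n ≠ 1 := fun h' => h ((hζ.zpow_eq_one_iff_dvd n).1 h')
    rw [geom_sum_eq hne, ← zpow_natCast, ← zpow_mul, mul_comm, zpow_mul, zpow_natCast, hζ.pow_eq_one]
    simp

lemma HasQExpansion.hecke {p : ℕ} (hp : 0 < p) {a : ℤ → ℤ} {f : ℂ → ℂ}
    (hf : HasQExpansion (fun n => a n) f) :
    HasQExpansion (fun n => heckeCoeff p a n) (hecke p f) := by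
  intro τ hτ
  have hp' : (p : ℂ) ≠ 0 := by exact_mod_cast hp.ne'
  have hpR : (0 : ℝ) < p := by exact_mod_cast hp
  have hinj : Function.Injective fun n : ℤ => (p : ℤ) * n :=
    mul_right_injective₀ (by exact_mod_cast hp.ne')
  have hrange : ∀ n : ℤ, n ∉ Set.range (fun n : ℤ => (p : ℤ) * n) → ¬ (p : ℤ) ∣ n :=
    fun n hn ⟨m, hm⟩ => hn ⟨m, hm.symm⟩
  have hU : HasSum (fun n : ℤ => (a (p * n) : ℂ) * nome τ ^ n)
      ((∑ b ∈ range p, f ((τ + b) / p)) / p) := by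
    have h1 : ∀ b ∈ range p, HasSum
        (fun n : ℤ => (a n : ℂ) * nome (τ / p) ^ n * nome ((b : ℂ) / p) ^ n) (f ((τ + b) / p)) := by
      intro b _
      have h2 := hf ((τ + b) / p) (by
        rw [show (τ + b) / p = ((p⁻¹ : ℝ) : ℂ) * (τ + b) by push_cast; field_simp,
          Complex.im_ofReal_mul]
        simpa using mul_pos (inv_pos.2 hpR) hτ)
      simpa only [add_div, nome_add, mul_zpow, mul_assoc] using h2
    have h3 := (hasSum_sum h1).div_const (p : ℂ)
    rw [← hinj.hasSum_iff] at h3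
    · refine h3.congr_fun fun n => ?_
      have h4 : nome (τ / p) ^ ((p : ℤ) * n) = nome τ ^ n := by
        rw [zpow_mul, zpow_natCast, ← nome_nat_mul, mul_div_cancel₀ _ hp']
      simp only [Function.comp_apply, ← mul_sum, sum_nome_zpow hp, dvd_mul_right, if_true, h4]
      field_simp
    · intro n hn
      simp only [← mul_sum, sum_nome_zpow hp, hrange n hn, if_false, mul_zero, zero_div]
  have hV : HasSum (fun n : ℤ => (if (p : ℤ) ∣ n then (a (n / p) : ℂ) else 0) * nome τ ^ n)
      (f (p * τ)) := by
    rw [← hinj.hasSum_iff]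
    · refine (hf (p * τ) (by simpa using mul_pos hpR hτ)).congr_fun fun n => ?_
      simp only [Function.comp_apply, dvd_mul_right, if_true, nome_nat_mul]
      rw [Int.mul_ediv_cancel_left _ (by exact_mod_cast hp.ne'), zpow_mul, zpow_natCast]
    · intro n hn
      simp only [hrange n hn, if_false, zero_mul]
  refine (hU.add (hV.mul_left (legendreThree p * p ^ 4 : ℂ))).congr_fun fun n => ?_
  simp only [heckeCoeff]
  push_cast
  ring

/-- `T_p` commutes with the Fricke involution up to the factor `χ₃(p)`. -/
lemma IsFrickePair.hecke {p : ℕ} [Fact p.Prime] (hp3 : p ≠ 3) {f g : ℂ → ℂ}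
    (h : IsFrickePair f g) (hf : IsPeriodic f) (hg : IsPeriodic g) :
    IsFrickePair (hecke p f) (fun τ => legendreThree p * hecke p g τ) := by
  intro τ hτ
  have hp : p.Prime := Fact.out
  have hp' : (p : ℂ) ≠ 0 := by exact_mod_cast hp.ne_zero
  have hpR : (0 : ℝ) < p := by exact_mod_cast hp.pos
  have h0 := ne_zero_of_im_pos hτ
  have hχ : (legendreThree p : ℂ) ^ 2 = 1 := by
    exact_mod_cast legendreThree_sq (n := p) (by
      rw [show (3 : ℤ) = ((3 : ℕ) : ℤ) from rfl, Int.natCast_dvd_natCast,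
        Nat.prime_dvd_prime_iff_eq Nat.prime_three hp]
      exact Ne.symm hp3)
  have himdiv : ∀ {σ : ℂ}, 0 < σ.im → 0 < (σ / p).im := fun {σ} hσ => by
    rw [show σ / p = ((p⁻¹ : ℝ) : ℂ) * σ by push_cast; field_simp, Complex.im_ofReal_mul]
    positivity
  have himmul : ∀ {σ : ℂ}, 0 < σ.im → 0 < (p * σ).im := fun {σ} hσ => by
    simpa using mul_pos hpR hσ
  have hrange : ∀ F : ℕ → ℂ, ∑ b ∈ range p, F b = ∑ b : ZMod p, F b.val := fun F => by
    obtain ⟨n, rfl⟩ := Nat.exists_eq_succ_of_ne_zero hp.ne_zero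
    exact (Fin.sum_univ_eq_sum_range F (n + 1)).symm
  -- the terms `b = 0` of the average and the term `f (p τ)` are exchanged
  have hzero : f (-1 / (3 * τ) / p) = (p * τ) ^ 5 * g (p * τ) := by
    rw [← h _ (himmul hτ)]
    congr 1
    field_simp
  have hlast : f (p * (-1 / (3 * τ))) = (τ / p) ^ 5 * g (τ / p) := by
    rw [← h _ (himdiv hτ)]
    congr 1
    field_simp
  have h3 : (3 : ZMod p) ≠ 0 := by
    have : ((3 : ℕ) : ZMod p) ≠ 0 := by
      rw [Ne, ZMod.natCast_eq_zero_iff, Nat.prime_dvd_prime_iff_eq hp Nat.prime_three]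
      exact hp3
    exact_mod_cast this
  -- the other terms are permuted by `b ↦ -1/(3b)`
  have hterm : ∀ b : ZMod p, b ≠ 0 → f ((-1 / (3 * τ) + b.val) / p)
      = legendreThree p * τ ^ 5 * g ((τ + (-(3 * b))⁻¹.val) / p) := by
    intro b hb
    set b' : ZMod p := (-(3 * b))⁻¹ with hb'
    have hdvd : (p : ℤ) ∣ 1 + 3 * b.val * b'.val := by
      rw [← ZMod.intCast_zmod_eq_zero_iff_dvd]
      push_cast
      rw [ZMod.natCast_zmod_val, ZMod.natCast_zmod_val, hb']
      field_simp
      ring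
    obtain ⟨m, hm⟩ := hdvd
    have him : 0 < (τ + (b'.val : ℂ)).im := by
      rwa [Complex.add_im, Complex.natCast_im, add_zero]
    have hσ := himdiv him
    have hσ0 := ne_zero_of_im_pos him
    have hw := im_fricke_pos hσ
    have key := h.apply_gammaZero hf hg m b.val b'.val p (by rw [mul_comm m, ← hm]; ring) hw
    rw [h _ hσ] at key
    have hmC : (p : ℂ) * m = 1 + 3 * b.val * b'.val := by exact_mod_cast hm.symm
    have e1 : 3 * ((b'.val : ℤ) : ℂ) * (-1 / (3 * ((τ + b'.val) / p))) + ((p : ℤ) : ℂ)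
        = p * τ / (τ + b'.val) := by
      push_cast
      field_simp
      ring
    have e2 : (m : ℂ) * (-1 / (3 * ((τ + b'.val) / p))) + ((b.val : ℤ) : ℂ)
        = (3 * b.val * τ - 1) / (3 * (τ + b'.val)) := by
      push_cast
      field_simp
      linear_combination -hmC
    rw [e1, e2] at key
    have e3 : (3 * b.val * τ - 1) / (3 * (τ + b'.val)) / (p * τ / (τ + b'.val))
        = (-1 / (3 * τ) + b.val) / p := by
      field_simp
      ring
    rw [e3] at key
    rw [key]
    field_simp
  have hperm : ∑ b ∈ univ.erase (0 : ZMod p), g ((τ + (-(3 * b))⁻¹.val) / p)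
      = ∑ b ∈ univ.erase (0 : ZMod p), g ((τ + b.val) / p) := by
    refine sum_bij' (fun b _ => (-(3 * b))⁻¹) (fun b _ => (-(3 * b))⁻¹) ?_ ?_ ?_ ?_ ?_
    · intro b hb
      simp_all
    · intro b hb
      simp_all
    · intro b hb
      have : b ≠ 0 := ne_of_mem_erase hb
      field_simp
    · intro b hb
      have : b ≠ 0 := ne_of_mem_erase hb
      field_simp
    · intro b hb
      rfl
  simp only [FrickeDefect.hecke]
  rw [hrange, hrange, ← add_sum_erase _ _ (mem_univ (0 : ZMod p)),
    ← add_sum_erase _ _ (mem_univ (0 : ZMod p)),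
    sum_congr rfl fun b hb => hterm b (ne_of_mem_erase hb), ← mul_sum, hperm, hlast]
  simp only [ZMod.val_zero, Nat.cast_zero, add_zero, hzero]
  set S := ∑ b ∈ univ.erase (0 : ZMod p), g ((τ + b.val) / p)
  field_simp
  linear_combination (-(p : ℂ) ^ 5 * g (p * τ)) * hχ

lemma HasQExpansion.isPeriodic {a : ℤ → ℂ} {f : ℂ → ℂ} (hf : HasQExpansion a f) : IsPeriodic f :=
  fun _ k hτ => hf.periodic hτ k

open PowerSeries

/-! ### Evaluation of power series -/

/-- The power series `P` converges at the point `x` to the value `z`. -/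
def HasEval (P : ℂ⟦X⟧) (x z : ℂ) : Prop := HasSum (fun n : ℕ => coeff n P * x ^ n) z

lemma HasEval.mul {P Q : ℂ⟦X⟧} {x z w : ℂ} (hP : HasEval P x z) (hQ : HasEval Q x w) :
    HasEval (P * Q) x (z * w) := by
  have hs := summable_norm_sum_mul_antidiagonal_of_summable_norm hP.summable.norm hQ.summable.norm
  have ht := tsum_mul_tsum_eq_tsum_sum_antidiagonal_of_summable_norm hP.summable.norm
    hQ.summable.norm
  rw [hP.tsum_eq, hQ.tsum_eq] at ht
  rw [ht]
  refine hs.of_norm.hasSum.congr_fun fun n => ?_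
  rw [coeff_mul, sum_mul]
  refine sum_congr rfl fun ij hij => ?_
  rw [← mem_antidiagonal.1 hij, pow_add]
  ring

lemma hasEval_one (x : ℂ) : HasEval 1 x 1 := by
  refine (hasSum_ite_eq 0 (1 : ℂ)).congr_fun fun n => ?_
  rw [coeff_one]
  split_ifs with h <;> simp [h]

lemma HasEval.pow {P : ℂ⟦X⟧} {x z : ℂ} (hP : HasEval P x z) (k : ℕ) : HasEval (P ^ k) x (z ^ k) := by
  induction k with
  | zero => simpa using hasEval_one x
  | succ k ih => simpa only [pow_succ] using ih.mul hP

/-- The coefficients, indexed by the integers, of the Laurent series `q^k P`. -/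
noncomputable def shiftCoeff {R : Type*} [Semiring R] (k : ℤ) (P : R⟦X⟧) (n : ℤ) : R :=
  if k ≤ n then coeff (n - k).toNat P else 0

lemma shiftCoeff_of_lt {R : Type*} [Semiring R] {k n : ℤ} (P : R⟦X⟧) (h : n < k) :
    shiftCoeff k P n = 0 := if_neg (not_le.2 h)

lemma shiftCoeff_self {R : Type*} [Semiring R] (k : ℤ) (P : R⟦X⟧) :
    shiftCoeff k P k = constantCoeff P := by
  simp [shiftCoeff]

lemma shiftCoeff_map {R S : Type*} [Semiring R] [Semiring S] (φ : R →+* S) (k : ℤ) (P : R⟦X⟧)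
    (n : ℤ) : shiftCoeff k (P.map φ) n = φ (shiftCoeff k P n) := by
  unfold shiftCoeff
  split_ifs <;> simp

lemma hasQExpansion_shiftCoeff {P : ℂ⟦X⟧} {F : ℂ → ℂ} (k : ℤ)
    (h : ∀ τ : ℂ, 0 < τ.im → HasEval P (nome τ) (F τ)) :
    HasQExpansion (shiftCoeff k P) (fun τ => nome τ ^ k * F τ) := by
  intro τ hτ
  have hinj : Function.Injective fun n : ℕ => (n : ℤ) + k := fun a b hab => by simpa using hab
  rw [← hinj.hasSum_iff]
  · refine ((h τ hτ).mul_left (nome τ ^ k)).congr_fun fun n => ?_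
    simp only [Function.comp_apply, shiftCoeff, le_add_iff_nonneg_left, Nat.cast_nonneg, if_true,
      add_sub_cancel_right, Int.toNat_natCast]
    rw [zpow_add₀ (nome_ne_zero τ), zpow_natCast]
    ring
  · intro n hn
    rw [shiftCoeff, if_neg, zero_mul]
    exact fun hk => hn ⟨(n - k).toNat, by simp; lia⟩

lemma exists_nome_eq {x : ℂ} (hx0 : x ≠ 0) (hx : ‖x‖ < 1) : ∃ τ : ℂ, 0 < τ.im ∧ nome τ = x := by
  have h2 : (2 * Real.pi * I : ℂ) ≠ 0 := Complex.two_pi_I_ne_zero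
  have he : nome (Complex.log x / (2 * Real.pi * I)) = x := by
    rw [nome, mul_div_cancel₀ _ h2, Complex.exp_log hx0]
  refine ⟨_, ?_, he⟩
  have h1 := norm_nome (Complex.log x / (2 * Real.pi * I))
  rw [he] at h1
  rw [h1, Real.exp_lt_one_iff] at hx
  have := Real.pi_pos
  by_contra! h
  nlinarith

/-- The inverse of a power series converging on the unit disc to a function without zeros
converges there to the inverse function. -/
lemma HasEval.of_mul_eq_one {P Q : ℂ⟦X⟧} {F : ℂ → ℂ} (hPQ : P * Q = 1)
    (hP : ∀ x : ℂ, ‖x‖ < 1 → HasEval P x (F x)) (hd : DifferentiableOn ℂ F (Metric.ball 0 1))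
    (h0 : ∀ x : ℂ, ‖x‖ < 1 → F x ≠ 0) {x : ℂ} (hx : ‖x‖ < 1) : HasEval Q x (F x)⁻¹ := by
  -- the Taylor series of the inverse function is also a formal inverse of `P`
  let R : ℂ⟦X⟧ := PowerSeries.mk fun n => (n.factorial : ℂ)⁻¹ * iteratedDeriv n (fun x => (F x)⁻¹) 0
  have hR : ∀ x : ℂ, ‖x‖ < 1 → HasEval R x (F x)⁻¹ := fun x hx => by
    have hd' : DifferentiableOn ℂ (fun x => (F x)⁻¹) (Metric.ball 0 1) :=
      hd.inv fun x hx => h0 x (by simpa using hx)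
    have h := Complex.hasSum_taylorSeries_on_ball (r := 1) (by simpa using hd')
      (by simpa using hx : x ∈ Metric.ball 0 _)
    refine h.congr_fun fun n => ?_
    simp [R]
    ring
  suffices hRQ : R = Q from hRQ ▸ hR x hx
  have hPR : P * R = 1 := by
    have h1 := hasQExpansion_shiftCoeff (P := P * R) (F := fun _ => 1) 0 fun τ hτ => by
      have hn := norm_nome_lt_one hτ
      have := (hP _ hn).mul (hR _ hn)
      rwa [mul_inv_cancel₀ (h0 _ hn)] at this
    have h2 := hasQExpansion_shiftCoeff (F := fun _ => 1) 0 fun τ _ => hasEval_one (nome τ)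
    have h3 := (h1.sub h2).eq_zero (fun τ _ => sub_self _) (M := 0) fun n hn => by
      simp [shiftCoeff_of_lt _ hn]
    ext n
    have := h3 n
    simpa [shiftCoeff, sub_eq_zero] using this
  calc R = Q * P * R := by rw [mul_comm Q, hPQ, one_mul]
    _ = Q := by rw [mul_assoc, hPR, mul_one]

/-! ### Euler products -/

section Euler

open scoped PowerSeries.WithPiTopology

/-- The Euler product `∏ (1 - X^(d n))` over the integers. -/
noncomputable def eulerInt (d : ℕ) : ℤ⟦X⟧ := ∏' n : ℕ, ((1 : ℤ⟦X⟧) - X ^ (d * (n + 1)))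

lemma tendsto_order_neg_X_pow {R : Type*} [CommRing R] [Nontrivial R] {d : ℕ} (hd : 0 < d) :
    Tendsto (fun n : ℕ => (-(X : R⟦X⟧) ^ (d * (n + 1))).order) atTop (𝓝 ⊤) := by
  refine ENat.tendsto_nhds_top_iff_natCast_lt.mpr fun n => eventually_atTop.mpr ⟨n, fun m hm => ?_⟩
  rw [order_neg, order_X_pow]
  norm_cast
  nlinarith

lemma map_eulerInt (R : Type*) [CommRing R] [Nontrivial R] [TopologicalSpace R]
    [IsTopologicalRing R] [T2Space R] {d : ℕ} (hd : 0 < d) :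
    (eulerInt d).map (Int.castRingHom R) = ∏' n : ℕ, ((1 : R⟦X⟧) + -X ^ (d * (n + 1))) := by
  have hm : Multipliable fun n : ℕ => (1 : ℤ⟦X⟧) - X ^ (d * (n + 1)) := by
    simp_rw [sub_eq_add_neg]
    exact WithPiTopology.multipliable_one_add_of_tendsto_order_atTop_nhds_top _
      (tendsto_order_neg_X_pow hd)
  have hc : Continuous (PowerSeries.map (Int.castRingHom R)) := by
    rw [continuous_iff_continuousAt]
    intro f
    rw [ContinuousAt, WithPiTopology.tendsto_iff_coeff_tendsto]
    intro n
    simp only [coeff_map]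
    exact ((continuous_of_discreteTopology (f := Int.castRingHom R)).comp
      (WithPiTopology.continuous_coeff ℤ n)).tendsto f
  rw [eulerInt, hm.map_tprod _ hc]
  simp [sub_eq_add_neg]

lemma eulerProduct_eq_map {d : ℕ} (hd : 0 < d) :
    eulerProduct d = (eulerInt d).map (Int.castRingHom ℚ) := by
  rw [map_eulerInt ℚ hd, eulerProduct]
  simp_rw [sub_eq_add_neg]

lemma constantCoeff_eulerInt {d : ℕ} (hd : 0 < d) : constantCoeff (eulerInt d) = 1 := by
  have h := constantCoeff_eulerProduct d hd
  rw [eulerProduct_eq_map hd, ← coeff_zero_eq_constantCoeff_apply, coeff_map,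
    coeff_zero_eq_constantCoeff_apply, eq_intCast] at h
  exact_mod_cast h

/-- The formal Euler product converges on the unit disc to the infinite product: both are expanded
as a sum over finite sets of exponents. -/
lemma hasEval_eulerInt {d : ℕ} (hd : 0 < d) {x : ℂ} (hx : ‖x‖ < 1) :
    HasEval ((eulerInt d).map (Int.castRingHom ℂ)) x (∏' n : ℕ, (1 - x ^ (d * (n + 1)))) := by
  let w : Finset ℕ → ℕ := fun s => ∑ i ∈ s, d * (i + 1)
  have hprod : ∀ {R : Type} [CommRing R] (y : R) (s : Finset ℕ),
      ∏ i ∈ s, -y ^ (d * (i + 1)) = (-1) ^ #s * y ^ w s := fun y s => by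
    rw [prod_neg, prod_pow_eq_pow_sum]
  have hnorm : Summable fun n : ℕ => ‖-x ^ (d * (n + 1))‖ := by
    have h1 : ‖x‖ ^ d < 1 := pow_lt_one₀ (norm_nonneg _) hx hd.ne'
    have := (summable_nat_add_iff 1).2 (summable_geometric_of_lt_one (by positivity) h1)
    simpa [pow_mul] using this
  have hsum := summable_finsetProd_of_summable_norm hnorm
  have hA : HasSum (fun s : Finset ℕ => (-1 : ℂ) ^ #s * x ^ w s)
      (∏' n : ℕ, (1 - x ^ (d * (n + 1)))) := by
    simp_rw [sub_eq_add_neg]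
    rw [tprod_one_add hsum]
    refine hsum.hasSum.congr_fun fun s => ?_
    rw [hprod]
  have hF : HasSum (fun s : Finset ℕ => (-1 : ℂ⟦X⟧) ^ #s * X ^ w s)
      ((eulerInt d).map (Int.castRingHom ℂ)) := by
    have h := WithPiTopology.summable_prod_of_tendsto_order_atTop_nhds_top ℂ
      (tendsto_order_neg_X_pow (R := ℂ) hd)
    rw [map_eulerInt ℂ hd, tprod_one_add h]
    refine h.hasSum.congr_fun fun s => ?_
    rw [hprod]
  refine (hA.tsum_fiberwise w).congr_fun fun n => ?_
  have hn := ((WithPiTopology.hasSum_iff_hasSum_coeff ℂ).1 hF n).tsum_eq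
  rw [← hn, ← tsum_mul_right, tsum_subtype (w ⁻¹' {n}) fun s => (-1 : ℂ) ^ #s * x ^ w s]
  refine tsum_congr fun s => ?_
  have hc : coeff n ((-1 : ℂ⟦X⟧) ^ #s * X ^ w s) = (-1) ^ #s * if n = w s then 1 else 0 := by
    rw [show ((-1 : ℂ⟦X⟧) ^ #s) = PowerSeries.C ((-1) ^ #s) by simp, coeff_C_mul, coeff_X_pow]
  rw [hc]
  by_cases h : n = w s
  · simp [h]
  · simp [h, Ne.symm h]

end Euler

/-- The inverse over the integers of the Euler product. -/
noncomputable def eulerIntInv (d : ℕ) : ℤ⟦X⟧ := invOfUnit (eulerInt d) 1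

lemma eulerInt_mul_inv {d : ℕ} (hd : 0 < d) : eulerInt d * eulerIntInv d = 1 :=
  mul_invOfUnit _ _ (constantCoeff_eulerInt hd)

lemma constantCoeff_eulerIntInv {d : ℕ} : constantCoeff (eulerIntInv d) = 1 := by
  simp [eulerIntInv, constantCoeff_invOfUnit]

lemma tprod_one_sub_pow_mul (d : ℕ) (x : ℂ) :
    ∏' n : ℕ, (1 - x ^ (d * (n + 1))) = ∏' n : ℕ, (1 - (x ^ d) ^ (n + 1)) := by
  simp_rw [pow_mul]

lemma tprod_one_sub_pow_ne_zero {x : ℂ} (hx : ‖x‖ < 1) : ∏' n : ℕ, (1 - x ^ (n + 1)) ≠ 0 := by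
  by_cases h0 : x = 0
  · simp [h0]
  · obtain ⟨τ, hτ, rfl⟩ := exists_nome_eq h0 hx
    have := ModularForm.eta_tprod_ne_zero (show τ ∈ UpperHalfPlane.upperHalfPlaneSet from hτ)
    simpa only [ModularForm.eta_q_eq_pow, nome] using this

lemma hasEval_eulerIntInv {d : ℕ} (hd : 0 < d) {x : ℂ} (hx : ‖x‖ < 1) :
    HasEval ((eulerIntInv d).map (Int.castRingHom ℂ)) x (∏' n : ℕ, (1 - x ^ (d * (n + 1))))⁻¹ := by
  have hpow : ∀ x : ℂ, ‖x‖ < 1 → ‖x ^ d‖ < 1 := fun x hx => by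
    rw [norm_pow]
    exact pow_lt_one₀ (norm_nonneg _) hx hd.ne'
  refine HasEval.of_mul_eq_one (F := fun x => ∏' n : ℕ, (1 - x ^ (d * (n + 1)))) ?_
    (fun x hx => hasEval_eulerInt hd hx) ?_ (fun x hx => ?_) hx
  · rw [← map_mul, eulerInt_mul_inv hd, map_one]
  · simp_rw [tprod_one_sub_pow_mul]
    exact ModularForm.differentiableOn_tprod_one_sub_pow.comp (by fun_prop) fun x hx => by
      simpa using hpow x (by simpa using hx)
  · rw [tprod_one_sub_pow_mul]
    exact tprod_one_sub_pow_ne_zero (hpow x hx)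

/-! ### The Hauptmodul -/

/-- The power series `u` with `t = q u(q)`. -/
noncomputable def hauptUnit : ℤ⟦X⟧ := eulerInt 3 ^ 12 * eulerIntInv 1 ^ 12

/-- The power series `v` with `t⁻¹ = q⁻¹ v(q)`. -/
noncomputable def hauptUnitInv : ℤ⟦X⟧ := eulerInt 1 ^ 12 * eulerIntInv 3 ^ 12

lemma constantCoeff_hauptUnit : constantCoeff hauptUnit = 1 := by
  simp [hauptUnit, constantCoeff_eulerInt, constantCoeff_eulerIntInv]

lemma constantCoeff_hauptUnitInv : constantCoeff hauptUnitInv = 1 := by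
  simp [hauptUnitInv, constantCoeff_eulerInt, constantCoeff_eulerIntInv]

/-- The Hauptmodul `η(3τ)^12 / η(τ)^12` as a function. -/
noncomputable def haupt (τ : ℂ) : ℂ := ModularForm.eta (3 * τ) ^ 12 / ModularForm.eta τ ^ 12

lemma eta_pow_twelve_ne_zero {τ : ℂ} (hτ : 0 < τ.im) : ModularForm.eta τ ^ 12 ≠ 0 :=
  pow_ne_zero _ (ModularForm.eta_ne_zero hτ)

lemma haupt_ne_zero {τ : ℂ} (hτ : 0 < τ.im) : haupt τ ≠ 0 :=
  div_ne_zero (eta_pow_twelve_ne_zero (by rw [im_three_mul]; linarith)) (eta_pow_twelve_ne_zero hτ)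

lemma haupt_fricke {τ : ℂ} (hτ : 0 < τ.im) : haupt (-1 / (3 * τ)) = (729 * haupt τ)⁻¹ := by
  obtain ⟨s, hs, h⟩ := exists_eta_pow_twelve_neg_inv
  have hs0 : s ≠ 0 := fun h0 => by simp [h0] at hs
  have h0 := ne_zero_of_im_pos hτ
  have hτ3 : 0 < (3 * τ).im := by rw [im_three_mul]; linarith
  have h1 := eta_pow_twelve_ne_zero hτ
  have h2 := eta_pow_twelve_ne_zero hτ3
  rw [haupt, show 3 * (-1 / (3 * τ)) = -1 / τ by field_simp, h τ hτ, h _ hτ3, haupt]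
  field_simp
  norm_num

lemma haupt_eq {τ : ℂ} :
    haupt τ = nome τ * ((∏' n : ℕ, (1 - nome τ ^ (3 * (n + 1)))) ^ 12 *
      (∏' n : ℕ, (1 - nome τ ^ (1 * (n + 1))))⁻¹ ^ 12) := by
  have h1 : ∀ z : ℂ, Function.Periodic.qParam 24 z ^ 12 = Complex.exp (Real.pi * I * z) := fun z => by
    rw [Function.Periodic.qParam, ← Complex.exp_nat_mul]
    congr 1
    push_cast
    ring
  have h2 : Complex.exp (Real.pi * I * (3 * τ)) = nome τ * Complex.exp (Real.pi * I * τ) := by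
    rw [nome, ← Complex.exp_add]
    ring_nf
  have h3 : ∀ z : ℂ, ModularForm.eta z ^ 12
      = Complex.exp (Real.pi * I * z) * (∏' n : ℕ, (1 - nome z ^ (n + 1))) ^ 12 := fun z => by
    simp only [ModularForm.eta, mul_pow, h1, ModularForm.eta_q_eq_pow]
    rfl
  have h4 : nome (3 * τ) = nome τ ^ 3 := by exact_mod_cast nome_nat_mul 3 τ
  have h5 := Complex.exp_ne_zero (Real.pi * I * τ)
  rw [haupt, h3, h3, h2, h4]
  simp only [tprod_one_sub_pow_mul, pow_one, inv_pow]
  field_simp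

lemma hasEval_hauptUnit {τ : ℂ} (hτ : 0 < τ.im) :
    HasEval (hauptUnit.map (Int.castRingHom ℂ)) (nome τ) (haupt τ / nome τ) := by
  rw [haupt_eq, mul_div_cancel_left₀ _ (nome_ne_zero τ), hauptUnit, map_mul, map_pow, map_pow]
  have hn := norm_nome_lt_one hτ
  exact ((hasEval_eulerInt (by norm_num) hn).pow 12).mul
    ((hasEval_eulerIntInv (by norm_num) hn).pow 12)

lemma hasEval_hauptUnitInv {τ : ℂ} (hτ : 0 < τ.im) :
    HasEval (hauptUnitInv.map (Int.castRingHom ℂ)) (nome τ) (nome τ / haupt τ) := by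
  have h := (((hasEval_eulerInt (d := 1) (by norm_num) (norm_nome_lt_one hτ)).pow 12).mul
    ((hasEval_eulerIntInv (d := 3) (by norm_num) (norm_nome_lt_one hτ)).pow 12))
  rw [hauptUnitInv, map_mul, map_pow, map_pow]
  convert h using 1
  rw [haupt_eq]
  have := nome_ne_zero τ
  rw [div_mul_cancel_left₀ this, mul_inv, inv_pow, inv_inv, inv_pow, mul_comm]

/-! ### Lambert series -/

/-- Rearrangement of a Lambert type double series into a power series with divisor sums as
coefficients. -/
lemma hasSum_divisorsAntidiagonal {w : ℕ → ℕ → ℤ} (hw : ∀ c n, |w c n| ≤ 1) {x : ℂ} (hx : ‖x‖ < 1) :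
    HasSum (fun N : ℕ => ((∑ z ∈ (N + 1).divisorsAntidiagonal, w z.1 z.2 * z.2 ^ 4 : ℤ) : ℂ)
      * x ^ (N + 1)) (∑' c : ℕ+, ∑' n : ℕ+, (w c n : ℂ) * n ^ 4 * x ^ (c * n : ℕ)) := by
  have hs : Summable fun z : ℕ+ × ℕ+ => (w z.1 z.2 : ℂ) * z.2 ^ 4 * x ^ (z.1 * z.2 : ℕ) := by
    refine Summable.of_norm_bounded (summable_prod_mul_pow 4 hx).norm fun z => ?_
    rw [mul_assoc, norm_mul, Complex.norm_intCast]
    refine mul_le_of_le_one_left (norm_nonneg _) ?_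
    exact_mod_cast hw z.1 z.2
  rw [← hs.tsum_prod (f := fun z : ℕ+ × ℕ+ => (w z.1 z.2 : ℂ) * z.2 ^ 4 * x ^ (z.1 * z.2 : ℕ))]
  have h1 := sigmaAntidiagonalEquivProd.hasSum_iff.2 hs.hasSum
  have h2 : HasSum (fun N : ℕ+ =>
      ((∑ z ∈ (N : ℕ).divisorsAntidiagonal, w z.1 z.2 * z.2 ^ 4 : ℤ) : ℂ) * x ^ (N : ℕ))
      (∑' z : ℕ+ × ℕ+, (w z.1 z.2 : ℂ) * z.2 ^ 4 * x ^ (z.1 * z.2 : ℕ)) := by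
    refine h1.sigma fun N => ?_
    have h3 := hasSum_fintype fun z : (N : ℕ).divisorsAntidiagonal =>
      (w z.1.1 z.1.2 : ℂ) * z.1.2 ^ 4 * x ^ (N : ℕ)
    rw [Finset.univ_eq_attach, sum_attach _ fun z : ℕ × ℕ => (w z.1 z.2 : ℂ) * z.2 ^ 4 * x ^ (N : ℕ),
      ← sum_mul] at h3
    push_cast
    refine h3.congr_fun fun z => ?_
    have h4 := (Nat.mem_divisorsAntidiagonal.1 z.2).1
    simp [sigmaAntidiagonalEquivProd, divisorsAntidiagonalFactors, h4]
  rw [← Equiv.pnatEquivNat.symm.hasSum_iff] at h2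
  exact h2

/-! ### The two Eisenstein series of weight `5` -/

lemma abs_legendreThree_le_one (n : ℤ) : |legendreThree n| ≤ 1 := by
  have : ∀ a : ZMod 3, |quadraticChar (ZMod 3) a| ≤ 1 := by decide
  exact this _

lemma legendreThree_natCast_eq {n r m : ℕ} (h : n = 3 * m + r) :
    legendreThree n = legendreThree r := by
  rw [h]
  push_cast
  rw [add_comm, legendreThree_add_three_mul]

lemma legendreThree_two : legendreThree 2 = -1 := by
  simpa using (legendreThree_add_three_mul (-1) 1).trans legendreThree_neg_one

/-- The character `χ₃` as a multiple of the sine. -/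
lemma sin_two_pi_mul_div_three (n : ℕ) :
    Real.sin (2 * Real.pi * n * (1 / 3)) = √3 / 2 * legendreThree n := by
  obtain ⟨m, r, hr, rfl⟩ : ∃ m r : ℕ, r < 3 ∧ n = 3 * m + r :=
    ⟨n / 3, n % 3, Nat.mod_lt _ (by norm_num), (Nat.div_add_mod n 3).symm⟩
  rw [legendreThree_natCast_eq rfl,
    show 2 * Real.pi * (3 * m + r : ℕ) * (1 / 3) = 2 * Real.pi * r / 3 + m * (2 * Real.pi) by
      push_cast; ring, Real.sin_add_nat_mul_two_pi]
  interval_cases r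
  · simp [legendreThree_zero]
  · rw [show 2 * Real.pi * (1 : ℕ) / 3 = Real.pi - Real.pi / 3 by push_cast; ring, Real.sin_pi_sub,
      Real.sin_pi_div_three]
    simp [legendreThree_one]
  · rw [show 2 * Real.pi * (2 : ℕ) / 3 = Real.pi / 3 + Real.pi by push_cast; ring, Real.sin_add_pi,
      Real.sin_pi_div_three]
    simp [legendreThree_two]

/-- The Gauss sum of `χ₃`. -/
lemma nome_sub_nome (n : ℕ) :
    nome (1 / 3) ^ n - nome (2 / 3) ^ n = I * √3 * legendreThree n := by
  have h1 : nome (2 / 3) ^ n = nome (-(n / 3)) := by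
    rw [← nome_nat_mul, show (n * (2 / 3) : ℂ) = -(n / 3) + (n : ℤ) by push_cast; ring,
      nome_add_int]
  rw [h1, ← nome_nat_mul, nome, nome]
  have h2 := congrArg (fun x : ℝ => (x : ℂ)) (sin_two_pi_mul_div_three n)
  simp only [Complex.ofReal_sin] at h2
  push_cast at h2
  rw [Complex.sin] at h2
  have h3 : (I : ℂ) ^ 2 = -1 := Complex.I_sq
  rw [show (2 * Real.pi * I * (n * (1 / 3)) : ℂ) = 2 * Real.pi * n * (1 / 3) * I by ring,
    show (2 * Real.pi * I * -(n / 3) : ℂ) = -(2 * Real.pi * n * (1 / 3)) * I by ring]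
  linear_combination (2 * I) * h2 - (Complex.exp (2 * Real.pi * n * (1 / 3) * I)
    - Complex.exp (-(2 * Real.pi * n * (1 / 3)) * I)) * -h3

lemma eval_bernoulli_five (x : ℚ) :
    (Polynomial.bernoulli 5).eval x = x ^ 5 - 5 / 2 * x ^ 4 + 5 / 3 * x ^ 3 - x / 6 := by
  have h3 : _root_.bernoulli 3 = 0 := bernoulli_eq_zero_of_odd (by decide) (by norm_num)
  have h5 : _root_.bernoulli 5 = 0 := bernoulli_eq_zero_of_odd (by decide) (by norm_num)
  have h4 : _root_.bernoulli 4 = -1 / 30 := by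
    rw [bernoulli_eq_bernoulli'_of_ne_one (by norm_num), bernoulli'_four]
  simp [Polynomial.bernoulli, Finset.sum_range_succ, h3, h4, h5,
    show Nat.choose 5 2 = 10 from rfl]
  ring

/-- The value `L(5, χ₃)`. -/
noncomputable def lValue : ℝ := 4 * Real.pi ^ 5 / (729 * √3)

lemma lValue_ne_zero : lValue ≠ 0 := by
  unfold lValue
  positivity

/-- The Fourier series of the fifth Bernoulli polynomial at `1/3` is that of `L(5, χ₃)`. -/
lemma hasSum_lValue : HasSum (fun n : ℕ => (legendreThree n : ℝ) * ((n : ℝ) ^ 5)⁻¹) lValue := by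
  have h := hasSum_one_div_nat_pow_mul_sin (k := 2) (by norm_num) (x := 1 / 3) (by norm_num)
  have hB : (Polynomial.map (algebraMap ℚ ℝ) (Polynomial.bernoulli (2 * 2 + 1))).eval (1 / 3)
      = -5 / 243 := by
    have hQ : (Polynomial.bernoulli (2 * 2 + 1)).eval (1 / 3 : ℚ) = -5 / 243 := by
      rw [eval_bernoulli_five]
      norm_num
    rw [show (1 / 3 : ℝ) = algebraMap ℚ ℝ (1 / 3) by simp, Polynomial.eval_map_apply, hQ]
    simp
  rw [hB] at h
  have h3 : (√3 : ℝ) ≠ 0 := by positivity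
  have hL : lValue = 2 / √3 *
      ((-1) ^ (2 + 1) * (2 * Real.pi) ^ (2 * 2 + 1) / 2 / (2 * 2 + 1).factorial * (-5 / 243)) := by
    unfold lValue
    norm_num [Nat.factorial]
    field_simp
    norm_num
  rw [hL]
  refine (h.mul_left (2 / √3)).congr_fun fun n => ?_
  rw [sin_two_pi_mul_div_three]
  field_simp

/-- The constant of the Lipschitz formula in weight `5`. -/
noncomputable def lipschitzConst : ℂ := (-2 * Real.pi * I) ^ 5 / 24

lemma lipschitzConst_ne_zero : lipschitzConst ≠ 0 := by
  have h1 : (Real.pi : ℂ) ≠ 0 := by exact_mod_cast Real.pi_ne_zero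
  have h2 := Complex.I_ne_zero
  unfold lipschitzConst
  simp [h1]

lemma lipschitzConst_eq : (3 ^ 5)⁻¹ * lipschitzConst * (I * √3) = 3 * lValue := by
  have h1 : (I : ℂ) ^ 6 = -1 := by
    rw [show 6 = 4 + 2 by norm_num, pow_add, Complex.I_pow_four, Complex.I_sq, one_mul]
  have h2 : ((√3 : ℝ) : ℂ) ^ 2 = 3 := by
    exact_mod_cast Real.sq_sqrt (by norm_num : (0 : ℝ) ≤ 3)
  have h3 : ((√3 : ℝ) : ℂ) ≠ 0 := fun h => by simp [h] at h2
  rw [lipschitzConst, lValue]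
  push_cast
  field_simp
  linear_combination (-23328 * ((√3 : ℝ) : ℂ) ^ 2) * h1 + 23328 * h2

/-- The Lipschitz formula in weight `5`. -/
lemma tsum_inv_add_int_pow_five {τ : ℂ} (hτ : 0 < τ.im) :
    ∑' n : ℤ, ((τ + n) ^ 5)⁻¹ = lipschitzConst * ∑' n : ℕ+, (n : ℂ) ^ 4 * nome τ ^ (n : ℕ) := by
  have h := EisensteinSeries.qExpansion_identity_pnat (k := 4) (by norm_num) ⟨τ, hτ⟩
  simpa [lipschitzConst, Nat.factorial, nome] using h

lemma summable_inv_pow_five {τ : ℂ} (hτ : 0 < τ.im) :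
    Summable fun z : ℤ × ℤ => (((z.1 : ℂ) * τ + z.2) ^ 5)⁻¹ := by
  have h := summable_prod_eisSummand (k := 5) (by norm_num) ⟨τ, hτ⟩
  refine h.congr fun z => ?_
  simp [EisensteinSeries.eisSummand, zpow_neg]

lemma summable_mul_inv_pow_five {τ : ℂ} (hτ : 0 < τ.im) {w : ℤ × ℤ → ℤ} (hw : ∀ z, |w z| ≤ 1) :
    Summable fun z : ℤ × ℤ => (w z : ℂ) * (((z.1 : ℂ) * τ + z.2) ^ 5)⁻¹ := by
  refine Summable.of_norm_bounded (summable_inv_pow_five hτ).norm fun z => ?_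
  rw [norm_mul, Complex.norm_intCast]
  refine mul_le_of_le_one_left (norm_nonneg _) ?_
  exact_mod_cast hw z

/-- The lattice sum `∑ χ₃(d) (3cτ + d)^(-5)`. -/
noncomputable def latticeInfty (τ : ℂ) : ℂ :=
  ∑' z : ℤ × ℤ, (legendreThree z.2 : ℂ) * (((z.1 : ℂ) * (3 * τ) + z.2) ^ 5)⁻¹

/-- The lattice sum `∑ χ₃(c) (cτ + d)^(-5)`. -/
noncomputable def latticeZero (τ : ℂ) : ℂ :=
  ∑' z : ℤ × ℤ, (legendreThree z.1 : ℂ) * (((z.1 : ℂ) * τ + z.2) ^ 5)⁻¹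

/-- The involution `τ ↦ -1/(3τ)` exchanges the two lattice sums. -/
lemma latticeInfty_fricke {τ : ℂ} (hτ : 0 < τ.im) :
    latticeInfty (-1 / (3 * τ)) = τ ^ 5 * latticeZero τ := by
  have h0 := ne_zero_of_im_pos hτ
  let e : ℤ × ℤ ≃ ℤ × ℤ :=
    { toFun := fun z => (z.2, -z.1)
      invFun := fun z => (-z.2, z.1)
      left_inv := fun z => by simp
      right_inv := fun z => by simp }
  rw [latticeInfty, latticeZero, ← tsum_mul_left, ← e.tsum_eq (fun z : ℤ × ℤ =>
    τ ^ 5 * ((legendreThree z.1 : ℂ) * (((z.1 : ℂ) * τ + z.2) ^ 5)⁻¹))]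
  refine tsum_congr fun z => ?_
  have h1 : (z.1 : ℂ) * (3 * (-1 / (3 * τ))) + z.2 = ((z.2 : ℂ) * τ + (-z.1 : ℤ)) / τ := by
    push_cast
    field_simp
    ring
  simp only [e, Equiv.coe_fn_mk]
  rw [h1, div_pow, inv_div]
  ring

lemma nome_mul_add (c n : ℕ) (τ σ : ℂ) : nome (c * τ + σ) ^ n = nome τ ^ (c * n) * nome σ ^ n := by
  rw [nome_add, nome_nat_mul, mul_pow, pow_mul]

lemma latticeZero_eq {τ : ℂ} (hτ : 0 < τ.im) :
    latticeZero τ = 2 * lipschitzConst * ∑' c : ℕ+, ∑' n : ℕ+,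
      (legendreThree (c : ℕ) : ℂ) * (n : ℕ) ^ 4 * nome τ ^ (c * n : ℕ) := by
  have hs := summable_mul_inv_pow_five hτ (w := fun z => legendreThree z.1)
    fun z => abs_legendreThree_le_one _
  rw [latticeZero, hs.tsum_prod, tsum_int_eq_zero_add_two_mul_tsum_pnat (fun c => ?_) hs.prod]
  · have hc : ∀ c : ℕ+, ∑' d : ℤ, (legendreThree ((c : ℕ) : ℤ) : ℂ) *
        (((((c : ℕ) : ℤ) : ℂ) * τ + d) ^ 5)⁻¹ = lipschitzConst * ∑' n : ℕ+,
        (legendreThree (c : ℕ) : ℂ) * (n : ℕ) ^ 4 * nome τ ^ (c * n : ℕ) := by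
      intro c
      have hcτ : 0 < ((c : ℕ) * τ : ℂ).im := by simpa using hτ
      rw [tsum_mul_left, Int.cast_natCast, tsum_inv_add_int_pow_five hcτ, mul_left_comm,
        ← tsum_mul_left]
      congr 1
      refine tsum_congr fun n => ?_
      rw [nome_nat_mul, ← pow_mul, mul_assoc]
    simp only [hc, tsum_mul_left, Int.cast_zero, legendreThree_zero, zero_mul, tsum_zero, zero_add]
    simp [mul_assoc]
  · rw [← (Equiv.neg ℤ).tsum_eq]
    refine tsum_congr fun d => ?_
    simp only [Equiv.neg_apply, legendreThree_neg]
    push_cast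
    rw [show -(c : ℂ) * τ + -d = -(c * τ + d) by ring, Odd.neg_pow (by decide), inv_neg]
    ring

lemma tsum_int_residues_three {F : ℤ → ℂ} (hF : Summable F) :
    ∑' d, F d = ∑' m : ℤ, (F (3 * m) + F (3 * m + 1) + F (3 * m + 2)) := by
  have h := (Int.divModEquiv 3).symm.summable_iff.2 hF
  rw [← (Int.divModEquiv 3).symm.tsum_eq]
  refine h.tsum_prod.trans (tsum_congr fun m => ?_)
  rw [tsum_fintype, Fin.sum_univ_three]
  simp [Int.divModEquiv]
  ring_nf

/-- The inner sums of `latticeInfty`: the residues `±1` modulo `3` give the Lipschitz formula at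
`cτ + 1/3` and `cτ + 2/3`, and the difference of the two is a Gauss sum. -/
lemma tsum_legendreThree_mul {τ : ℂ} (hτ : 0 < τ.im) (c : ℕ+) :
    ∑' d : ℤ, (legendreThree d : ℂ) * (((((c : ℕ) : ℤ) : ℂ) * (3 * τ) + d) ^ 5)⁻¹
      = 3 * lValue * ∑' n : ℕ+,
        (legendreThree (n : ℕ) : ℂ) * (n : ℕ) ^ 4 * nome τ ^ (c * n : ℕ) := by
  have h3τ : 0 < (3 * τ).im := by rw [im_three_mul]; linarith
  have hs : Summable fun d : ℤ =>
      (legendreThree d : ℂ) * (((((c : ℕ) : ℤ) : ℂ) * (3 * τ) + d) ^ 5)⁻¹ :=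
    (summable_mul_inv_pow_five h3τ (w := fun z => legendreThree z.2)
      fun z => abs_legendreThree_le_one _).prod_factor ((c : ℕ) : ℤ)
  have h1 : 0 < ((c : ℕ) * τ + 1 / 3 : ℂ).im := by
    rw [show (1 / 3 : ℂ) = ((1 / 3 : ℝ) : ℂ) by push_cast; rfl]
    simpa using hτ
  have h2 : 0 < ((c : ℕ) * τ + 2 / 3 : ℂ).im := by
    rw [show (2 / 3 : ℂ) = ((2 / 3 : ℝ) : ℂ) by push_cast; rfl]
    simpa using hτ
  have hsum : ∀ {σ : ℂ}, 0 < σ.im → Summable fun m : ℤ => ((σ + m) ^ 5)⁻¹ := fun {σ} hσ => by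
    simpa using (summable_inv_pow_five hσ).prod_factor 1
  have hsum' : ∀ {σ : ℂ}, 0 < σ.im → Summable fun n : ℕ+ => (n : ℂ) ^ 4 * nome σ ^ (n : ℕ) :=
    fun {σ} hσ => by
      have := summable_pow_mul_cexp 4 1 ⟨σ, hσ⟩
      exact (this.comp_injective PNat.coe_injective).congr fun n => by simp [nome]
  have hm : ∀ m : ℤ,
      (legendreThree (3 * m) : ℂ) * (((((c : ℕ) : ℤ) : ℂ) * (3 * τ) + (3 * m : ℤ)) ^ 5)⁻¹
      + (legendreThree (3 * m + 1) : ℂ) * (((((c : ℕ) : ℤ) : ℂ) * (3 * τ) + (3 * m + 1 : ℤ)) ^ 5)⁻¹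
      + (legendreThree (3 * m + 2) : ℂ) * (((((c : ℕ) : ℤ) : ℂ) * (3 * τ) + (3 * m + 2 : ℤ)) ^ 5)⁻¹
      = (3 ^ 5)⁻¹ * (((((c : ℕ) * τ + 1 / 3 : ℂ) + m) ^ 5)⁻¹
        - ((((c : ℕ) * τ + 2 / 3 : ℂ) + m) ^ 5)⁻¹) := by
    intro m
    have hχ : ∀ r : ℤ, legendreThree (3 * m + r) = legendreThree r := fun r => by
      rw [add_comm, legendreThree_add_three_mul]
    have hχ0 := hχ 0
    rw [add_zero] at hχ0
    rw [hχ, hχ, hχ0, legendreThree_zero, legendreThree_one, legendreThree_two]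
    push_cast
    rw [mul_sub, ← mul_inv, ← mul_inv, ← mul_pow, ← mul_pow]
    ring_nf
  rw [tsum_int_residues_three hs, tsum_congr hm, tsum_mul_left,
    (hsum h1).tsum_sub (hsum h2), tsum_inv_add_int_pow_five h1, tsum_inv_add_int_pow_five h2,
    ← mul_sub, ← (hsum' h1).tsum_sub (hsum' h2), ← mul_assoc, ← tsum_mul_left, ← tsum_mul_left]
  refine tsum_congr fun n => ?_
  rw [nome_mul_add, nome_mul_add]
  linear_combination ((3 ^ 5)⁻¹ * lipschitzConst * (n : ℂ) ^ 4 * nome τ ^ (c * n : ℕ))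
    * nome_sub_nome n + (legendreThree (n : ℕ) * (n : ℂ) ^ 4 * nome τ ^ (c * n : ℕ))
    * lipschitzConst_eq

lemma latticeInfty_eq {τ : ℂ} (hτ : 0 < τ.im) :
    latticeInfty τ = 2 * lValue * (1 + 3 * ∑' c : ℕ+, ∑' n : ℕ+,
      (legendreThree (n : ℕ) : ℂ) * (n : ℕ) ^ 4 * nome τ ^ (c * n : ℕ)) := by
  have h3τ : 0 < (3 * τ).im := by rw [im_three_mul]; linarith
  have hs := summable_mul_inv_pow_five h3τ (w := fun z => legendreThree z.2)
    fun z => abs_legendreThree_le_one _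
  rw [latticeInfty, hs.tsum_prod, tsum_int_eq_zero_add_two_mul_tsum_pnat (fun c => ?_) hs.prod]
  · have h0 : ∑' d : ℤ, (legendreThree d : ℂ) * ((((0 : ℤ) : ℂ) * (3 * τ) + d) ^ 5)⁻¹
        = 2 * lValue := by
      have hs0 := hs.prod_factor 0
      rw [tsum_int_eq_zero_add_two_mul_tsum_pnat (fun d => ?_) hs0]
      · have hL : HasSum (fun n : ℕ => (legendreThree n : ℂ) * ((n : ℂ) ^ 5)⁻¹) lValue :=
          (Complex.hasSum_ofReal.2 hasSum_lValue).congr_fun fun n => by push_cast; rfl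
        have hL' := hL.tsum_eq
        rw [← tsum_zero_pnat_eq_tsum_nat hL.summable] at hL'
        simp [legendreThree_zero] at hL' ⊢
        exact hL'
      · simp only [legendreThree_neg]
        push_cast
        rw [zero_mul, zero_add, zero_add, Odd.neg_pow (by decide), inv_neg]
        ring
    simp only [tsum_legendreThree_mul hτ, h0, tsum_mul_left, nsmul_eq_mul]
    push_cast
    ring
  · rw [← (Equiv.neg ℤ).tsum_eq]
    refine tsum_congr fun d => ?_
    simp only [Equiv.neg_apply, legendreThree_neg]
    push_cast
    rw [show -(c : ℂ) * (3 * τ) + -d = -(c * (3 * τ) + d) by ring, Odd.neg_pow (by decide), inv_neg]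
    ring

/-- The integral power series `C = 1 + 3 ∑ (∑_{d ∣ n} χ₃(d) d^4) q^n`. -/
noncomputable def eisInfty : ℤ⟦X⟧ := PowerSeries.mk fun n =>
  if n = 0 then 1 else 3 * ∑ z ∈ n.divisorsAntidiagonal, legendreThree z.2 * z.2 ^ 4

/-- The integral power series `G` for which `q G = ∑ (∑_{d ∣ n} χ₃(n/d) d^4) q^n`. -/
noncomputable def eisZero : ℤ⟦X⟧ := PowerSeries.mk fun n =>
  ∑ z ∈ (n + 1).divisorsAntidiagonal, legendreThree z.1 * z.2 ^ 4

lemma constantCoeff_eisInfty : constantCoeff eisInfty = 1 := by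
  simp [eisInfty, ← coeff_zero_eq_constantCoeff_apply]

lemma constantCoeff_eisZero : constantCoeff eisZero = 1 := by
  simp [eisZero, ← coeff_zero_eq_constantCoeff_apply, legendreThree_one]

lemma hasEval_eisInfty {τ : ℂ} (hτ : 0 < τ.im) :
    HasEval (eisInfty.map (Int.castRingHom ℂ)) (nome τ) (latticeInfty τ / (2 * lValue)) := by
  have hL : (lValue : ℂ) ≠ 0 := by exact_mod_cast lValue_ne_zero
  have h := (hasSum_divisorsAntidiagonal (w := fun _ n => legendreThree n)
    (fun _ _ => abs_legendreThree_le_one _) (norm_nome_lt_one hτ)).mul_left 3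
  rw [latticeInfty_eq hτ, mul_div_cancel_left₀ _ (by simpa using hL), HasEval, ← hasSum_nat_add_iff' 1]
  simp only [range_one, sum_singleton, pow_zero, mul_one, coeff_map, eisInfty, coeff_mk, if_true]
  simp only [eq_intCast, Int.cast_one, add_sub_cancel_left, Nat.add_eq_zero_iff, one_ne_zero,
    and_false, if_false]
  refine h.congr_fun fun n => ?_
  push_cast
  ring

lemma hasEval_eisZero {τ : ℂ} (hτ : 0 < τ.im) :
    HasEval (eisZero.map (Int.castRingHom ℂ)) (nome τ)
      (latticeZero τ / (2 * lipschitzConst) / nome τ) := by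
  have h := (hasSum_divisorsAntidiagonal (w := fun c _ => legendreThree c)
    (fun _ _ => abs_legendreThree_le_one _) (norm_nome_lt_one hτ)).div_const (nome τ)
  have h2 : 2 * lipschitzConst ≠ 0 := by simpa using lipschitzConst_ne_zero
  rw [latticeZero_eq hτ, mul_div_cancel_left₀ _ h2]
  refine h.congr_fun fun n => ?_
  have := nome_ne_zero τ
  simp only [eisZero, coeff_map, coeff_mk, eq_intCast, pow_succ]
  field_simp

/-! ### The two systems of weakly holomorphic forms -/

/-- The coefficients of `C / t^j`. -/
noncomputable def inftyCoeff (j : ℕ) : ℤ → ℤ := shiftCoeff (-j) (eisInfty * hauptUnitInv ^ j)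

/-- The coefficients of `G t^j`, where `G` is the Eisenstein series conjugate to `C`. -/
noncomputable def zeroCoeff (j : ℕ) : ℤ → ℤ := shiftCoeff (j + 1) (eisZero * hauptUnit ^ j)

lemma inftyCoeff_of_lt {j : ℕ} {n : ℤ} (h : n < -j) : inftyCoeff j n = 0 := shiftCoeff_of_lt _ h

lemma zeroCoeff_of_lt {j : ℕ} {n : ℤ} (h : n < j + 1) : zeroCoeff j n = 0 := shiftCoeff_of_lt _ h

lemma inftyCoeff_self (j : ℕ) : inftyCoeff j (-j) = 1 := by
  rw [inftyCoeff, shiftCoeff_self]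
  simp [constantCoeff_eisInfty, constantCoeff_hauptUnitInv]

lemma zeroCoeff_self (j : ℕ) : zeroCoeff j (j + 1) = 1 := by
  rw [zeroCoeff, shiftCoeff_self]
  simp [constantCoeff_eisZero, constantCoeff_hauptUnit]

/-- The function `C / t^j`. -/
noncomputable def inftyForm (j : ℕ) (τ : ℂ) : ℂ := latticeInfty τ / (2 * lValue) / haupt τ ^ j

/-- The function `G t^j`. -/
noncomputable def zeroForm (j : ℕ) (τ : ℂ) : ℂ := latticeZero τ / (2 * lipschitzConst) * haupt τ ^ j

lemma hasQExpansion_inftyForm (j : ℕ) : HasQExpansion (fun n => inftyCoeff j n) (inftyForm j) := by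
  have h := hasQExpansion_shiftCoeff (-j : ℤ) fun τ hτ =>
    (hasEval_eisInfty hτ).mul ((hasEval_hauptUnitInv hτ).pow j)
  refine h.congr (fun n => ?_) fun τ hτ => ?_
  · rw [← map_pow, ← map_mul, shiftCoeff_map, eq_intCast]
    rfl
  · have h1 := nome_ne_zero τ
    have h2 := haupt_ne_zero hτ
    rw [inftyForm, zpow_neg, zpow_natCast, div_pow]
    field_simp

lemma hasQExpansion_zeroForm (j : ℕ) : HasQExpansion (fun n => zeroCoeff j n) (zeroForm j) := by
  have h := hasQExpansion_shiftCoeff (j + 1 : ℤ) fun τ hτ =>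
    (hasEval_eisZero hτ).mul ((hasEval_hauptUnit hτ).pow j)
  refine h.congr (fun n => ?_) fun τ hτ => ?_
  · rw [← map_pow, ← map_mul, shiftCoeff_map, eq_intCast]
    rfl
  · have h1 := nome_ne_zero τ
    rw [zeroForm, zpow_add₀ h1, zpow_natCast, zpow_one, div_pow]
    field_simp

/-- `C / t^j` and a constant multiple of `G t^j` are conjugate; `729 = 3^6` comes from
`t(-1/(3τ)) = 1/(3^6 t(τ))`. -/
lemma isFrickePair_inftyForm (j : ℕ) :
    IsFrickePair (inftyForm j) (fun τ => lipschitzConst / lValue * 729 ^ j * zeroForm j τ) := by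
  intro τ hτ
  have hL : (lValue : ℂ) ≠ 0 := by exact_mod_cast lValue_ne_zero
  have hK := lipschitzConst_ne_zero
  simp only [inftyForm, zeroForm]
  rw [latticeInfty_fricke hτ, haupt_fricke hτ, inv_pow, div_inv_eq_mul, mul_pow]
  field_simp

lemma hecke_const_mul (p : ℕ) (c : ℂ) (f : ℂ → ℂ) (τ : ℂ) :
    hecke p (fun τ => c * f τ) τ = c * hecke p f τ := by
  simp only [hecke, ← mul_sum]
  ring

/-- `T_p (C / t^m)` is an integral combination of the `C / t^j`, and the image of this identity
under the Fricke involution expresses `T_p (G t^m)` by the `G t^j`. -/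
lemma exists_hecke_combination {p : ℕ} [Fact p.Prime] (hp3 : p ≠ 3) (m : ℕ) :
    ∃ A : ℕ → ℤ, (∀ n, heckeCoeff p (inftyCoeff m) n
        = ∑ j ∈ range (p * m + 1), A j * inftyCoeff j n) ∧
      ∀ n, legendreThree p * 729 ^ m * heckeCoeff p (zeroCoeff m) n
        = ∑ j ∈ range (p * m + 1), A j * 729 ^ j * zeroCoeff j n := by
  have hp : 0 < p := (Fact.out : p.Prime).pos
  have hcoeff : ∀ {a : ℤ → ℤ} {k n : ℤ}, (∀ n < k, a n = 0) → p * n < k → n < p * k →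
      heckeCoeff p a n = 0 := by
    intro a k n ha h1 h2
    rw [heckeCoeff, ha _ h1]
    split_ifs with hd
    · rw [ha _ (Int.ediv_lt_of_lt_mul (by exact_mod_cast hp) (by rwa [mul_comm]))]
      simp
    · simp
  -- `T_p (C / t^m)` has a pole of order at most `p m`
  obtain ⟨A, hA⟩ := exists_principalPart_combination inftyCoeff (fun j n => inftyCoeff_of_lt)
    inftyCoeff_self (p * m) (heckeCoeff p (inftyCoeff m)) (fun n hn => by
      have hp1 : (1 : ℤ) ≤ p := by exact_mod_cast hp
      have hm : (0 : ℤ) ≤ m := by positivity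
      push_cast at hn
      have h1 : ((p : ℤ) - 1) * n ≤ 0 := mul_nonpos_of_nonneg_of_nonpos (by linarith) (by nlinarith)
      have h2 : 0 ≤ ((p : ℤ) - 1) * m := mul_nonneg (by linarith) hm
      exact hcoeff (fun _ => inftyCoeff_of_lt) (by linarith) (by linarith))
  have hf := hasQExpansion_inftyForm
  have hg := hasQExpansion_zeroForm
  set κ : ℂ := lipschitzConst / lValue with hκ
  have hκ0 : κ ≠ 0 := div_ne_zero lipschitzConst_ne_zero (by exact_mod_cast lValue_ne_zero)
  -- the difference of the two sides, and its Fricke conjugate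
  have hD := ((hf m).hecke hp).sub
    (HasQExpansion.sum (s := range (p * m + 1)) fun j _ => (hf j).const_mul (A j))
  have hD' := (((hg m).hecke hp).const_mul (legendreThree p * (κ * 729 ^ m))).sub
    (HasQExpansion.sum (s := range (p * m + 1)) fun j _ => (hg j).const_mul (A j * (κ * 729 ^ j)))
  have hpair : IsFrickePair
      (fun τ => hecke p (inftyForm m) τ - ∑ j ∈ range (p * m + 1), A j * inftyForm j τ)
      (fun τ => legendreThree p * (κ * 729 ^ m) * hecke p (zeroForm m) τ
        - ∑ j ∈ range (p * m + 1), A j * (κ * 729 ^ j) * zeroForm j τ) := by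
    intro τ hτ
    have h1 := (isFrickePair_inftyForm m).hecke hp3 (hf m).isPeriodic
      ((hg m).const_mul (κ * 729 ^ m)).isPeriodic τ hτ
    simp only [hecke_const_mul] at h1
    simp only [h1, isFrickePair_inftyForm _ τ hτ, mul_sub, mul_sum, ← hκ]
    congr 1
    · ring
    · exact sum_congr rfl fun j _ => by ring
  -- the difference vanishes at `i ∞` by the choice of `A`, its conjugate because `G t^j = O(q)`
  have hzero : ∀ τ : ℂ, 0 < τ.im → _ := fun τ hτ => hpair.eq_zero hD hD'
    (fun n hn => by
      rw [hA n hn]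
      push_cast
      exact sub_self _)
    (fun n hn => by
      rw [hcoeff (k := m + 1) (fun _ => zeroCoeff_of_lt) (by nlinarith) (by nlinarith),
        sum_eq_zero fun j _ => by rw [zeroCoeff_of_lt (by lia)]; simp]
      simp) hτ
  refine ⟨A, fun n => ?_, fun n => ?_⟩
  · have h := hD.eq_zero hzero (M := -(p * m : ℕ)) (fun n hn => by
      rw [hA n (by lia)]
      push_cast
      exact sub_self _) n
    rw [sub_eq_zero] at h
    exact_mod_cast h
  · have hzero' : ∀ τ : ℂ, 0 < τ.im → legendreThree p * (κ * 729 ^ m) * hecke p (zeroForm m) τ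
        - ∑ j ∈ range (p * m + 1), A j * (κ * 729 ^ j) * zeroForm j τ = 0 := fun τ hτ => by
      have h := hpair τ hτ
      have h2 := hzero _ (im_fricke_pos hτ)
      simp only at h h2
      rw [h2] at h
      simpa [ne_zero_of_im_pos hτ] using h.symm
    have h := hD'.eq_zero hzero' (M := 1) (fun n hn => by
      rw [hcoeff (k := m + 1) (fun _ => zeroCoeff_of_lt) (by nlinarith) (by nlinarith),
        sum_eq_zero fun j _ => by rw [zeroCoeff_of_lt (by lia)]; simp]
      simp) n
    rw [sub_eq_zero] at h
    have h2 : κ * (legendreThree p * 729 ^ m * heckeCoeff p (zeroCoeff m) n)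
        = κ * ∑ j ∈ range (p * m + 1), (A j : ℂ) * 729 ^ j * zeroCoeff j n := by
      rw [mul_sum]
      refine Eq.trans ?_ (h.trans (sum_congr rfl fun j _ => ?_)) <;> ring
    exact_mod_cast mul_left_cancel₀ hκ0 h2

/-- The congruence between the coefficients of `C / t^(rp)` and those of `C / t^r`. -/
lemma pow_four_dvd_inftyCoeff_sub {p : ℕ} [Fact p.Prime] (hp3 : p ≠ 3) (r : ℕ) (n : ℤ) :
    (p : ℤ) ^ 4 ∣ inftyCoeff (r * p) (p * n) - inftyCoeff r n := by
  have hp : p.Prime := Fact.out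
  have hp0 : (0 : ℤ) < p := by exact_mod_cast hp.pos
  obtain ⟨A, hA, hA'⟩ := exists_hecke_combination hp3 (r * p)
  -- modulo `p^4` the operator `T_p` is the decimation of coefficients
  have hV : ∀ a n, (p : ℤ) ^ 4 ∣ heckeCoeff p a n - a (p * n) := fun a n => by
    rw [heckeCoeff, add_sub_cancel_left, mul_right_comm]
    exact dvd_mul_left _ _
  have hcop : IsCoprime ((p : ℤ) ^ 4) 729 := by
    have : Nat.Coprime (p ^ 4) (3 ^ 6) :=
      Nat.Coprime.pow _ _ ((Nat.coprime_primes hp Nat.prime_three).2 hp3)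
    exact_mod_cast Nat.isCoprime_iff_coprime.2 this
  have key := dvd_sub_of_two_cusps hcop (fun j n => inftyCoeff_of_lt) inftyCoeff_self
    (fun j n => zeroCoeff_of_lt) zeroCoeff_self (M := p * (r * p)) (r := r)
    (by nlinarith [hp.one_lt, Nat.zero_le r, Nat.mul_le_mul_left r (Nat.mul_pos hp.pos hp.pos)]) hA hA'
    (fun n hn => by
      have := hV (inftyCoeff (r * p)) n
      rwa [inftyCoeff_of_lt (by push_cast; nlinarith), sub_zero] at this)
    (by
      have := hV (inftyCoeff (r * p)) (-r)
      rwa [show (p : ℤ) * -r = -(r * p : ℕ) by push_cast; ring, inftyCoeff_self] at this)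
    (fun n hn => by
      have := hV (zeroCoeff (r * p)) n
      rwa [zeroCoeff_of_lt (by push_cast; nlinarith), sub_zero] at this) n
  have := dvd_sub key (hV (inftyCoeff (r * p)) n)
  rwa [show ∀ x y z : ℤ, x - y - (x - z) = z - y by intros; ring] at this

/-! ### The coefficients of the defect -/

lemma chi3_eq (n : ℕ) : chi3 (n : ZMod 3) = legendreThree n := by
  simp [chi3, legendreThree, MulChar.ringHomComp_apply]

lemma generalizedBernoulli_five_chi3 : generalizedBernoulli 5 chi3 = -10 / 3 := by
  have h : Finset.Icc 1 3 = {1, 2, 3} := rfl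
  rw [generalizedBernoulli, h]
  simp only [chi3_eq, eval_bernoulli_five]
  simp [legendreThree_one, legendreThree_two,
    show legendreThree 3 = 0 from legendreThree_add_three_mul 0 1 ▸ legendreThree_zero]
  norm_num

lemma C_eq : C = ((eisInfty.map (Int.castRingHom ℚ) : ℚ⟦X⟧) : LaurentSeries ℚ) := by
  rw [C]
  congr 1
  ext n
  rw [← map_ofNat (PowerSeries.C (R := ℚ)) 3, coeff_C_mul]
  simp only [eisensteinQExp, coeff_mk, coeff_map, eisInfty]
  split_ifs with hn
  · rw [generalizedBernoulli_five_chi3]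
    norm_num
  · rw [Nat.sum_divisorsAntidiagonal' fun _ d => legendreThree d * (d : ℤ) ^ 4]
    simp [chi3_eq]

lemma inv_t_eq : t⁻¹ = HahnSeries.single (-1) 1 *
    ((hauptUnitInv.map (Int.castRingHom ℚ) : ℚ⟦X⟧) : LaurentSeries ℚ) := by
  have hE : ∀ d : ℕ, 0 < d → ((eulerProduct d : ℚ⟦X⟧) : LaurentSeries ℚ) *
      (((eulerIntInv d).map (Int.castRingHom ℚ) : ℚ⟦X⟧) : LaurentSeries ℚ) = 1 := fun d hd => by
    rw [eulerProduct_eq_map hd, ← PowerSeries.coe_mul, ← map_mul, eulerInt_mul_inv hd]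
    simp
  have h1 := hE 1 (by norm_num)
  have h3 := hE 3 (by norm_num)
  have hs : (HahnSeries.single (1 : ℤ) (1 : ℚ)) * HahnSeries.single (-1) 1 = 1 := by
    rw [HahnSeries.single_mul_single]
    simp
  have hv : ((hauptUnitInv.map (Int.castRingHom ℚ) : ℚ⟦X⟧) : LaurentSeries ℚ)
      = ((eulerProduct 1 : ℚ⟦X⟧) : LaurentSeries ℚ) ^ 12 *
        (((eulerIntInv 3).map (Int.castRingHom ℚ) : ℚ⟦X⟧) : LaurentSeries ℚ) ^ 12 := by
    rw [hauptUnitInv, map_mul, map_pow, map_pow, ← eulerProduct_eq_map (by norm_num)]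
    simp
  have h10 : ((eulerProduct 1 : ℚ⟦X⟧) : LaurentSeries ℚ) ≠ 0 := left_ne_zero_of_mul_eq_one h1
  rw [hv]
  refine inv_eq_of_mul_eq_one_right ?_
  rw [t]
  set E₁ := ((eulerProduct 1 : ℚ⟦X⟧) : LaurentSeries ℚ)
  set E₃ := ((eulerProduct 3 : ℚ⟦X⟧) : LaurentSeries ℚ)
  set V := (((eulerIntInv 3).map (Int.castRingHom ℚ) : ℚ⟦X⟧) : LaurentSeries ℚ)
  set s := HahnSeries.single (1 : ℤ) (1 : ℚ)
  set s' := HahnSeries.single (-1 : ℤ) (1 : ℚ)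
  calc s * E₃ ^ 12 / E₁ ^ 12 * (s' * (E₁ ^ 12 * V ^ 12))
      = (s * s') * (E₃ * V) ^ 12 * (E₁ ^ 12 / E₁ ^ 12) := by ring
    _ = 1 := by rw [hs, h3, div_self (pow_ne_zero _ h10)]; ring

lemma coeff_C_div_t_pow (j : ℕ) (n : ℤ) : (C / t ^ j).coeff n = inftyCoeff j n := by
  have h : C / t ^ j = HahnSeries.single (-j : ℤ) 1 *
      (((eisInfty * hauptUnitInv ^ j).map (Int.castRingHom ℚ) : ℚ⟦X⟧) : LaurentSeries ℚ) := by
    rw [div_eq_mul_inv, ← inv_pow, inv_t_eq, mul_pow, HahnSeries.single_pow, C_eq]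
    simp
    ring
  rw [h, HahnSeries.coeff_single_mul, one_mul, PowerSeries.coeff_coe, inftyCoeff, shiftCoeff]
  simp only [sub_neg_eq_add, coeff_map, eq_intCast]
  by_cases hn : -(j : ℤ) ≤ n
  · rw [if_neg (by lia), if_pos hn, show (n + j).natAbs = (n + j).toNat by lia]
  · rw [if_pos (by lia), if_neg hn, Int.cast_zero]

lemma coeff_defect (p : ℕ) [NeZero p] (r : ℕ) (n : ℤ) :
    (defect p r).coeff n = (inftyCoeff (r * p) (p * n) - inftyCoeff r n : ℤ) := by
  have h : (Lambda p (C / t ^ (r * p))).coeff n = (C / t ^ (r * p)).coeff (n * p) := rfl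
  rw [defect, HahnSeries.coeff_sub, h, coeff_C_div_t_pow, coeff_C_div_t_pow, mul_comm n]
  push_cast
  rfl

end FrickeDefect

theorem mainTheorem2 (p : ℕ) [Fact p.Prime] (hp : 5 ≤ p) (r : ℕ) (hr1 : 1 ≤ r) (hr3 : r ≤ 3) :
    FrickeDefect.SeriesModEq p 4 (FrickeDefect.defect p r) 0 ∧
      (FrickeDefect.SeriesModEq p 4 (FrickeDefect.defect p r) 0 ↔
        ∀ s : ℕ, 1 ≤ s → s ≤ r → FrickeDefect.RatModEq p 4 (FrickeDefect.delta p r s) 0) := by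
  have h : FrickeDefect.SeriesModEq p 4 (FrickeDefect.defect p r) 0 := by
    intro n
    obtain ⟨k, hk⟩ := FrickeDefect.pow_four_dvd_inftyCoeff_sub (p := p) (by lia) r n
    refine ⟨k, ?_, ?_⟩
    · simpa using (Fact.out : p.Prime).ne_one
    · rw [FrickeDefect.coeff_defect, hk]
      simp
  exact ⟨h, fun _ s _ _ => h _, fun _ => h⟩
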